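/- Let $d\ge 1$, $p\in(2,\infty)$ and $0<\varepsilon\le 1$. Put $\alpha=\frac{p-2}{p-1}$, $\beta=\frac{p-2}{p+d}$, $\gamma=\sqrt{2(p+d)}$, $J_p(\xi)=\operatorname{sign}(\xi)|\xi|^{\frac1{p-1}}$, $m(\varepsilon)=\varepsilon^{\frac{2}{2+\alpha}}$, $M(\varepsilon)=\varepsilon^{-\frac{2}{2-\alpha}}$; $B_r(x)$ denotes the open ball in $\mathbb R^d$. Let $\Omega\subset\mathbb R^d$ be open and bounded with the uniform exterior ball condition (there is $R>0$ such that for every $x_0\in\partial\Omega$ there is $z_0\in\mathbb R^d\setminus\Omega$ with $\overline{B_R(z_0)}\cap\overline\Omega=\{x_0\}$), let $f\in C(\overline\Omega)$, and let $g$ be a bounded continuous function on $\mathbb R^d\setminus\Omega$. **The dynamic programming principle.** For bounded Borel $\varphi:\mathbb R^d\to\mathbb R$ let $$\mathcal M_r[\varphi](x)=\beta\Big(\tfrac12\sup_{B_{\gamma r}(x)}\varphi+\tfrac12\inf_{B_{\gamma r}(x)}\varphi\Big)+(1-\beta)\,\frac1{|B_{\gamma r}(x)|}\int_{B_{\gamma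 r}(x)}\varphi(y)\,dy,$$ $$\mathcal A^+_\varepsilon[\varphi](x)=\inf_{c\in[m(\varepsilon),M(\varepsilon)]}\Big\{\alpha\sup_{B_{\varepsilon^2c^{1-\alpha}}(x)}\varphi+(1-\alpha)\mathcal M_{\varepsilon c^{-\alpha/2}}[\varphi](x)\Big\},$$ $$\mathcal A^-_\varepsilon[\varphi](x)=\sup_{c\in[m(\varepsilon),M(\varepsilon)]}\Big\{\alpha\inf_{B_{\varepsilon^2c^{1-\alpha}}(x)}\varphi+(1-\alpha)\mathcal M_{\varepsilon c^{-\alpha/2}}[\varphi](x)\Big\},$$ and let $\mathcal A_\varepsilon[\varphi;f](x)$ be $\mathcal A^+_\varepsilon[\varphi](x)$ if $f(x)\ge0$ and $\mathcal A^-_\varepsilon[\varphi](x)$ if $f(x)<0$. A solution of the dynamic programming principle (DPP) is a bounded Borel function $u:\mathbb R^d\to\mathbb R$ with $$u(x)=\mathcal A_\varepsilon[u;f](x)-\varepsilon^2J_p(f(x))\ \text{ for }x\in\Omega,\qquad u(x)=g(x)\ \text{ for }x\in\mathbb R^d\setminus\Omega.$$ **The game.** Two players start at $x_0\in\mathbb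 R^d$. While the position $x$ is in $\Omega$ and $f(x)\ge0$, Player II selects $c\in[m(\varepsilon),M(\varepsilon)]$ and a coin with probability $\alpha$ of heads is tossed. On heads Player I, knowing $c$, chooses the next position in $B_{\varepsilon^2c^{1-\alpha}}(x)$. On tails a round of tug-of-war with noise is played in $B=B_{\gamma\varepsilon c^{-\alpha/2}}(x)$: with probability $\beta$ a fair coin decides which player chooses the next position in $B$, and with probability $1-\beta$ the next position is uniformly distributed in $B$. If $f(x)<0$ the roles are reversed: Player I selects $c$ and Player II chooses the position in $B_{\varepsilon^2c^{1-\alpha}}(x)$ on heads. (If $f\ge0$ in $\Omega$, only the first kind of round occurs.) The game stops at the first time $\tau$ with $x_\tau\notin\Omega$. A strategy $S_I$ or $S_{II}$ of a player is a Borel function prescribing that player's choices (of $c$, and of the positions given $c$) after each partial history $(x_0,\dots,x_k)$; a pair of strategies and a starting point $x$ determine the law $\mathbb P^{x}_{S_I,S_{II}}$ of the sequence of positions. Put $$X=-\varepsilon^2\sum_{i=0}^{\tau-1}J_p(f(x_i))+g(x_\tau),\qquad u_I^\varepsilon(x)=\sup_{S_I}\inf_{S_{II}}\mathbb E^{x}_{S_I,S_{II}}[X],\qquad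 u_{II}^\varepsilon(x)=\inf_{S_{II}}\sup_{S_I}\mathbb E^{x}_{S_I,S_{II}}[X].$$ **Theorem.** For all strategies $S_I,S_{II}$ and every starting point $x\in\mathbb R^d$, the game ends almost surely ($\mathbb P^{x}_{S_I,S_{II}}(\tau<\infty)=1$) and $X$ is integrable. The DPP has exactly one solution $u_\varepsilon$, and the game has a value, given by it: $$u_\varepsilon(x)=u_I^\varepsilon(x)=u_{II}^\varepsilon(x)\qquad\text{for all }x\in\mathbb R^d.$$ -/

import Mathlib

open MeasureTheory ProbabilityTheory Metric

namespace GamblingHouse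

/-! ### Constants -/

/-- `α = (p - 2) / (p - 1)`. -/
noncomputable def alpha (p : ℝ) : ℝ := (p - 2) / (p - 1)

/-- `β = (p - 2) / (p + d)`. -/
noncomputable def beta (p : ℝ) (d : ℕ) : ℝ := (p - 2) / (p + d)

/-- `γ = √(2 (p + d))`. -/
noncomputable def gamma (p : ℝ) (d : ℕ) : ℝ := Real.sqrt (2 * (p + d))

/-- The signed power `J_p(ξ) = sign(ξ) |ξ| ^ (1 / (p - 1))`. -/
noncomputable def J (p ξ : ℝ) : ℝ :=
  if 0 ≤ ξ then ξ ^ (1 / (p - 1)) else -((-ξ) ^ (1 / (p - 1)))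

/-- The lower end `m(ε) = ε ^ (2 / (2 + α))` of the range of `c`. -/
noncomputable def cMin (p ε : ℝ) : ℝ := ε ^ (2 / (2 + alpha p))

/-- The upper end `M(ε) = ε ^ (-2 / (2 - α))` of the range of `c`. -/
noncomputable def cMax (p ε : ℝ) : ℝ := ε ^ (-(2 / (2 - alpha p)))

/-- The radius `ε² c ^ (1 - α)` of the ball in which one player moves freely. -/
noncomputable def jumpRadius (p ε c : ℝ) : ℝ := ε ^ 2 * c ^ (1 - alpha p)

/-- The radius `γ ε c ^ (-α / 2)` of the ball for tug-of-war with noise. -/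
noncomputable def tugRadius (p : ℝ) (d : ℕ) (ε c : ℝ) : ℝ :=
  gamma p d * (ε * c ^ (-(alpha p / 2)))

/-- `ℝ^d` with its Euclidean norm. -/
abbrev Space (d : ℕ) : Type := EuclideanSpace ℝ (Fin d)

/-! ### The dynamic programming principle -/

/-- Half the sum of the supremum and the infimum, with weight `β`, plus the mean, with weight
`1 - β`, of `φ` on the open ball `B_{γ r}(x)`. -/
noncomputable def tugMean (p : ℝ) {d : ℕ} (r : ℝ) (φ : Space d → ℝ) (x : Space d) : ℝ :=
  beta p d * ((1 / 2) * sSup (φ '' ball x (gamma p d * r))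
      + (1 / 2) * sInf (φ '' ball x (gamma p d * r)))
    + (1 - beta p d) * ⨍ y in ball x (gamma p d * r), φ y

/-- `𝒜_ε⁺[φ](x)`. -/
noncomputable def Aplus (p : ℝ) {d : ℕ} (ε : ℝ) (φ : Space d → ℝ) (x : Space d) : ℝ :=
  sInf ((fun c : ℝ => alpha p * sSup (φ '' ball x (jumpRadius p ε c))
      + (1 - alpha p) * tugMean p (ε * c ^ (-(alpha p / 2))) φ x)
    '' Set.Icc (cMin p ε) (cMax p ε))

/-- `𝒜_ε⁻[φ](x)`. -/
noncomputable def Aminus (p : ℝ) {d : ℕ} (ε : ℝ) (φ : Space d → ℝ) (x : Space d) : ℝ :=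
  sSup ((fun c : ℝ => alpha p * sInf (φ '' ball x (jumpRadius p ε c))
      + (1 - alpha p) * tugMean p (ε * c ^ (-(alpha p / 2))) φ x)
    '' Set.Icc (cMin p ε) (cMax p ε))

/-- `𝒜_ε[φ; f](x)`: it is `𝒜_ε⁺[φ](x)` where `f(x) ≥ 0` and `𝒜_ε⁻[φ](x)` where `f(x) < 0`. -/
noncomputable def A (p : ℝ) {d : ℕ} (ε : ℝ) (φ f : Space d → ℝ) (x : Space d) : ℝ :=
  if 0 ≤ f x then Aplus p ε φ x else Aminus p ε φ x

/-- `u` is a bounded Borel solution of the dynamic programming principle with running payoff `f`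
in `Ω` and final payoff `g` outside `Ω`. -/
structure IsDPPSolution (p : ℝ) {d : ℕ} (ε : ℝ) (Ω : Set (Space d)) (f g : Space d → ℝ)
    (u : Space d → ℝ) : Prop where
  measurable : Measurable u
  bounded : ∃ C : ℝ, ∀ x, |u x| ≤ C
  eq_inside : ∀ x ∈ Ω, u x = A p ε u f x - ε ^ 2 * J p (f x)
  eq_outside : ∀ x, x ∉ Ω → u x = g x

/-- Uniform exterior ball condition. -/
def UniformExteriorBall {d : ℕ} (Ω : Set (Space d)) : Prop :=
  ∃ R > 0, ∀ x₀ ∈ frontier Ω, ∃ z₀, z₀ ∉ Ω ∧ closedBall z₀ R ∩ closure Ω = {x₀}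

/-! ### Strategies -/

/-- The partial history `(x₀, …, x_n)` of the positions of the game. -/
abbrev History (d n : ℕ) : Type := (i : Finset.Iic n) → (fun _ : ℕ => Space d) i

/-- The present position `x_n`. -/
def History.last {d n : ℕ} (h : History d n) : Space d := h ⟨n, Finset.mem_Iic.2 le_rfl⟩

/-- A (Borel) strategy. It fixes, after every partial history,
* the constant `c` the player selects whenever it is this player who selects `c`;
* given the selected `c`, the point the player moves to whenever the opponent has selected `c` and
  the first coin shows heads;
* given the selected `c`, the point the player moves to on winning a round of tug-of-war.
The two players have the same kinds of decisions to make, the sign of `f` deciding which of them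
selects `c`. A choice of the player who selects `c` that depends on the history alone is covered,
since `c` is then itself a function of the history. -/
structure Strategy (p : ℝ) (d : ℕ) (ε : ℝ) where
  select : (n : ℕ) → History d n → ℝ
  jump : (n : ℕ) → History d n × ℝ → Space d
  tug : (n : ℕ) → History d n × ℝ → Space d
  measurable_select : ∀ n, Measurable (select n)
  measurable_jump : ∀ n, Measurable (jump n)
  measurable_tug : ∀ n, Measurable (tug n)
  select_mem : ∀ n h, select n h ∈ Set.Icc (cMin p ε) (cMax p ε)
  jump_mem : ∀ n h, ∀ c ∈ Set.Icc (cMin p ε) (cMax p ε),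
    jump n (h, c) ∈ ball h.last (jumpRadius p ε c)
  tug_mem : ∀ n h, ∀ c ∈ Set.Icc (cMin p ε) (cMax p ε),
    tug n (h, c) ∈ ball h.last (tugRadius p d ε c)

/-! ### Transition laws -/

/-- Law of the next position after one round from `x` with constant `c`: with probability `α` it
is `y`; with probability `1 - α` a round of tug-of-war with noise is played, that is, with
probability `β` a fair coin decides between `z₁` and `z₂`, and with probability `1 - β` the next
position is uniformly distributed in the ball `B_{γ ε c ^ (-α / 2)}(x)`. -/
noncomputable def roundLaw (p : ℝ) {d : ℕ} (ε c : ℝ) (x y z₁ z₂ : Space d) : Measure (Space d) :=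
  ENNReal.ofReal (alpha p) • Measure.dirac y
    + ENNReal.ofReal (1 - alpha p) •
      (ENNReal.ofReal (beta p d) •
          (ENNReal.ofReal (1 / 2) • Measure.dirac z₁ + ENNReal.ofReal (1 / 2) • Measure.dirac z₂)
        + ENNReal.ofReal (1 - beta p d) • ProbabilityTheory.cond volume (ball x (tugRadius p d ε c)))

open Classical in
/-- Law of `x_{n+1}` given `x₀, …, x_n`. Where `f ≥ 0` the second player selects `c` and the first
player makes the free move; where `f < 0` the roles are reversed. Outside `Ω` the game is over and
the position no longer changes. -/
noncomputable def stepLaw (p : ℝ) {d : ℕ} (ε : ℝ) (Ω : Set (Space d)) (f : Space d → ℝ)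
    (S₁ S₂ : Strategy p d ε) (n : ℕ) (h : History d n) : Measure (Space d) :=
  if h.last ∈ Ω then
    if 0 ≤ f h.last then
      roundLaw p ε (S₂.select n h) h.last (S₁.jump n (h, S₂.select n h))
        (S₁.tug n (h, S₂.select n h)) (S₂.tug n (h, S₂.select n h))
    else
      roundLaw p ε (S₁.select n h) h.last (S₂.jump n (h, S₁.select n h))
        (S₁.tug n (h, S₁.select n h)) (S₂.tug n (h, S₁.select n h))
  else Measure.dirac h.last

theorem alpha_pos {p : ℝ} (hp : 2 < p) : 0 < alpha p := by
  unfold alpha; apply div_pos <;> linarith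

theorem alpha_lt_one {p : ℝ} (hp : 2 < p) : alpha p < 1 := by
  unfold alpha; rw [div_lt_one] <;> linarith

theorem beta_pos {p : ℝ} {d : ℕ} (hp : 2 < p) : 0 < beta p d := by
  unfold beta; apply div_pos <;> [linarith; positivity]

theorem beta_lt_one {p : ℝ} {d : ℕ} (hp : 2 < p) : beta p d < 1 := by
  have : (0 : ℝ) ≤ d := Nat.cast_nonneg d
  unfold beta; rw [div_lt_one] <;> linarith

theorem tugRadius_pos {p ε c : ℝ} {d : ℕ} (hp : 2 < p) (hε : 0 < ε) (hc : cMin p ε ≤ c) :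
    0 < tugRadius p d ε c := by
  have h0 : 0 < cMin p ε := Real.rpow_pos_of_pos hε _
  have h1 : 0 < c := lt_of_lt_of_le h0 hc
  have h2 : 0 < gamma p d := by unfold gamma; positivity
  have h3 : 0 < c ^ (-(alpha p / 2)) := Real.rpow_pos_of_pos h1 _
  unfold tugRadius; positivity

theorem ofReal_add_one_sub {a : ℝ} (h0 : 0 ≤ a) (h1 : a ≤ 1) :
    ENNReal.ofReal a + ENNReal.ofReal (1 - a) = 1 := by
  rw [← ENNReal.ofReal_add h0 (by linarith)]; simp

theorem isProbabilityMeasure_roundLaw {p ε c : ℝ} {d : ℕ} (hp : 2 < p) (hε : 0 < ε)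
    (hc : cMin p ε ≤ c) (x y z₁ z₂ : Space d) :
    IsProbabilityMeasure (roundLaw p ε c x y z₁ z₂) := by
  have hr : 0 < tugRadius p d ε c := tugRadius_pos hp hε hc
  have : IsProbabilityMeasure
      (ProbabilityTheory.cond (volume : Measure (Space d)) (ball x (tugRadius p d ε c))) :=
    cond_isProbabilityMeasure_of_finite (measure_ball_pos _ _ hr).ne' measure_ball_lt_top.ne
  have hhalf : ENNReal.ofReal (1 / 2) + ENNReal.ofReal (1 / 2) = 1 := by
    rw [← ENNReal.ofReal_add (by norm_num) (by norm_num)]; norm_num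
  constructor
  simp only [roundLaw, Measure.coe_add, Measure.coe_smul, Pi.add_apply, Pi.smul_apply,
    measure_univ, smul_eq_mul, mul_one, hhalf]
  rw [ofReal_add_one_sub (beta_pos hp).le (beta_lt_one hp).le, mul_one,
    ofReal_add_one_sub (alpha_pos hp).le (alpha_lt_one hp).le]

theorem isProbabilityMeasure_stepLaw {p ε : ℝ} {d : ℕ} (hp : 2 < p) (hε : 0 < ε)
    (Ω : Set (Space d)) (f : Space d → ℝ) (S₁ S₂ : Strategy p d ε) (n : ℕ) (h : History d n) :
    IsProbabilityMeasure (stepLaw p ε Ω f S₁ S₂ n h) := by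
  unfold stepLaw
  split_ifs
  · exact isProbabilityMeasure_roundLaw hp hε (S₂.select_mem n h).1 _ _ _ _
  · exact isProbabilityMeasure_roundLaw hp hε (S₁.select_mem n h).1 _ _ _ _
  · infer_instance

theorem measurable_cond_ball {d : ℕ} {T : Type*} [MeasurableSpace T] {x : T → Space d}
    {r : T → ℝ} (hx : Measurable x) (hr : Measurable r) :
    Measurable fun t => ProbabilityTheory.cond (volume : Measure (Space d)) (ball (x t) (r t)) := by
  have key : ∀ s : Set (Space d), MeasurableSet s →
      Measurable fun t => (volume : Measure (Space d)) (ball (x t) (r t) ∩ s) := by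
    intro s hs
    have hm : MeasurableSet {q : T × Space d | dist q.2 (x q.1) < r q.1 ∧ q.2 ∈ s} :=
      (measurableSet_lt (measurable_snd.dist (hx.comp measurable_fst))
        (hr.comp measurable_fst)).inter (measurable_snd hs)
    exact measurable_measure_prodMk_left hm
  refine Measure.measurable_of_measurable_coe _ fun s hs => ?_
  have h1 := key Set.univ MeasurableSet.univ
  simp only [Set.inter_univ] at h1
  simp only [cond_apply measurableSet_ball]
  exact h1.inv.mul (key s hs)

theorem measurable_roundLaw {p ε : ℝ} {d : ℕ} {T : Type*} [MeasurableSpace T] {c : T → ℝ}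
    {x y z₁ z₂ : T → Space d} (hc : Measurable c) (hx : Measurable x) (hy : Measurable y)
    (hz₁ : Measurable z₁) (hz₂ : Measurable z₂) :
    Measurable fun t => roundLaw p ε (c t) (x t) (y t) (z₁ t) (z₂ t) := by
  have hr : Measurable fun t => tugRadius p d ε (c t) := by
    unfold tugRadius
    exact ((hc.pow_const _).const_mul _).const_mul _
  refine Measure.measurable_of_measurable_coe _ fun s hs => ?_
  have hd : ∀ w : T → Space d, Measurable w → Measurable fun t => Measure.dirac (w t) s :=
    fun w hw => (Measure.measurable_coe hs).comp (Measure.measurable_dirac.comp hw)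
  have hb := (Measure.measurable_coe hs).comp (measurable_cond_ball hx hr)
  simp only [roundLaw, Measure.coe_add, Measure.coe_smul, Pi.add_apply, Pi.smul_apply, smul_eq_mul]
  exact ((hd _ hy).const_mul _).add ((((((hd _ hz₁).const_mul _).add
    ((hd _ hz₂).const_mul _)).const_mul _).add (hb.const_mul _)).const_mul _)

theorem measurable_last {d n : ℕ} : Measurable (History.last : History d n → Space d) :=
  measurable_pi_apply _

theorem measurable_stepLaw (p : ℝ) {d : ℕ} (ε : ℝ) {Ω : Set (Space d)} {f : Space d → ℝ}
    (hΩ : IsOpen Ω) (hf : ContinuousOn f (closure Ω)) (S₁ S₂ : Strategy p d ε) (n : ℕ) :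
    Measurable (stepLaw p ε Ω f S₁ S₂ n) := by
  classical
  have hpos : MeasurableSet (Ω ∩ {x | 0 ≤ f x}) := by
    obtain ⟨F, hF, hFe⟩ := continuousOn_iff_isClosed.1 (hf.mono subset_closure) _
      (isClosed_Ici (a := (0 : ℝ)))
    have : Ω ∩ {x | 0 ≤ f x} = F ∩ Ω := by rw [← hFe, Set.inter_comm]; rfl
    rw [this]
    exact hF.measurableSet.inter hΩ.measurableSet
  have e : stepLaw p ε Ω f S₁ S₂ n = fun h : History d n =>
      if h ∈ (History.last ⁻¹' (Ω ∩ {x | 0 ≤ f x}) : Set (History d n)) then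
        roundLaw p ε (S₂.select n h) h.last (S₁.jump n (h, S₂.select n h))
          (S₁.tug n (h, S₂.select n h)) (S₂.tug n (h, S₂.select n h))
      else if h ∈ (History.last ⁻¹' Ω : Set (History d n)) then
        roundLaw p ε (S₁.select n h) h.last (S₂.jump n (h, S₁.select n h))
          (S₁.tug n (h, S₁.select n h)) (S₂.tug n (h, S₁.select n h))
      else Measure.dirac h.last := by
    funext h
    by_cases h1 : h.last ∈ Ω <;> by_cases h2 : 0 ≤ f h.last <;> simp [stepLaw, h1, h2]
  have hm : ∀ S : Strategy p d ε, Measurable fun h : History d n => (h, S.select n h) :=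
    fun S => measurable_id.prodMk (S.measurable_select n)
  rw [e]
  refine Measurable.ite (measurable_last hpos) ?_ (Measurable.ite
    (measurable_last hΩ.measurableSet) ?_ (Measure.measurable_dirac.comp measurable_last))
  · exact measurable_roundLaw (S₂.measurable_select n) measurable_last
      ((S₁.measurable_jump n).comp (hm S₂)) ((S₁.measurable_tug n).comp (hm S₂))
      ((S₂.measurable_tug n).comp (hm S₂))
  · exact measurable_roundLaw (S₁.measurable_select n) measurable_last
      ((S₂.measurable_jump n).comp (hm S₁)) ((S₁.measurable_tug n).comp (hm S₁))
      ((S₂.measurable_tug n).comp (hm S₁))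

/-- The transition laws as kernels. -/
noncomputable def stepKernel {p : ℝ} {d : ℕ} {ε : ℝ} {Ω : Set (Space d)} {f : Space d → ℝ}
    (hΩ : IsOpen Ω) (hf : ContinuousOn f (closure Ω)) (S₁ S₂ : Strategy p d ε) (n : ℕ) :
    Kernel (History d n) (Space d) where
  toFun := stepLaw p ε Ω f S₁ S₂ n
  measurable' := measurable_stepLaw p ε hΩ hf S₁ S₂ n

theorem isMarkovKernel_stepKernel {p : ℝ} {d : ℕ} {ε : ℝ} {Ω : Set (Space d)} {f : Space d → ℝ}
    (hp : 2 < p) (hε : 0 < ε) (hΩ : IsOpen Ω) (hf : ContinuousOn f (closure Ω))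
    (S₁ S₂ : Strategy p d ε) (n : ℕ) : IsMarkovKernel (stepKernel hΩ hf S₁ S₂ n) :=
  ⟨fun h => isProbabilityMeasure_stepLaw hp hε Ω f S₁ S₂ n h⟩

/-! ### The game -/

/-- The law of the sequence of positions, started at `x₀`, when the players use the strategies
`S₁` and `S₂`: the measure on sequences determined by the transition laws. -/
noncomputable def gameLaw {p : ℝ} {d : ℕ} {ε : ℝ} {Ω : Set (Space d)} {f : Space d → ℝ}
    (hp : 2 < p) (hε : 0 < ε) (hΩ : IsOpen Ω) (hf : ContinuousOn f (closure Ω))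
    (S₁ S₂ : Strategy p d ε) (x₀ : Space d) : Measure (ℕ → Space d) :=
  haveI := fun n => isMarkovKernel_stepKernel hp hε hΩ hf S₁ S₂ n
  Kernel.traj (X := fun _ => Space d) (fun n => stepKernel hΩ hf S₁ S₂ n) 0 (fun _ => x₀)

/-- The first time `τ` at which the position is outside `Ω` (with the convention `τ = 0` if that
never happens). -/
noncomputable def exitTime {d : ℕ} (Ω : Set (Space d)) (ω : ℕ → Space d) : ℕ :=
  sInf {n | ω n ∉ Ω}

/-- The total payoff `-ε² ∑_{i < τ} J_p(f(x_i)) + g(x_τ)`. -/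
noncomputable def payoff (p : ℝ) {d : ℕ} (ε : ℝ) (Ω : Set (Space d)) (f g : Space d → ℝ)
    (ω : ℕ → Space d) : ℝ :=
  -(ε ^ 2 * ∑ i ∈ Finset.range (exitTime Ω ω), J p (f (ω i))) + g (ω (exitTime Ω ω))

/-- The expected payoff. -/
noncomputable def expectedPayoff {p : ℝ} {d : ℕ} {ε : ℝ} {Ω : Set (Space d)} {f : Space d → ℝ}
    (hp : 2 < p) (hε : 0 < ε) (hΩ : IsOpen Ω) (hf : ContinuousOn f (closure Ω)) (g : Space d → ℝ)
    (S₁ S₂ : Strategy p d ε) (x₀ : Space d) : ℝ :=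
  ∫ ω, payoff p ε Ω f g ω ∂(gameLaw hp hε hΩ hf S₁ S₂ x₀)

/-- The value of the game for Player I, as an extended real number. -/
noncomputable def valueI {p : ℝ} {d : ℕ} {ε : ℝ} {Ω : Set (Space d)} {f : Space d → ℝ}
    (hp : 2 < p) (hε : 0 < ε) (hΩ : IsOpen Ω) (hf : ContinuousOn f (closure Ω)) (g : Space d → ℝ)
    (x₀ : Space d) : EReal :=
  ⨆ S₁ : Strategy p d ε, ⨅ S₂ : Strategy p d ε,
    ((expectedPayoff hp hε hΩ hf g S₁ S₂ x₀ : ℝ) : EReal)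

/-- The value of the game for Player II, as an extended real number. -/
noncomputable def valueII {p : ℝ} {d : ℕ} {ε : ℝ} {Ω : Set (Space d)} {f : Space d → ℝ}
    (hp : 2 < p) (hε : 0 < ε) (hΩ : IsOpen Ω) (hf : ContinuousOn f (closure Ω)) (g : Space d → ℝ)
    (x₀ : Space d) : EReal :=
  ⨅ S₂ : Strategy p d ε, ⨆ S₁ : Strategy p d ε,
    ((expectedPayoff hp hε hΩ hf g S₁ S₂ x₀ : ℝ) : EReal)

end GamblingHouse

/-!
A function `Φ`, bounded and bounded below by `1`, whose mean drops by at least `1` in every round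
whatever the players do (`exists_lyapunov`), carries the proof. It exists because the uniform noise
has a fixed probability of moving the position ahead by a fixed length in a given direction, and `Ω`
is bounded.

* Summing the drops bounds the mean number of rounds, so the game ends almost surely and the payoff,
  which is dominated by a multiple of the number of rounds, is integrable
  (`lintegral_tsum_indicator_lt_top`, `integrable_payoff_and_tendsto`).
* The operator of the dynamic programming principle is a contraction for the sup norm weighted by
  `1 / Φ`, so it has exactly one bounded Borel fixed point `u` (`exists_unique_isDPPSolution`).
* Playing nearly optimally for `u` in each round makes `u(x_n)` plus the payoff collected so far a
  submartingale (for Player I) or a supermartingale (for Player II) up to a small error per round,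
  and a small multiple of `Φ` absorbs these errors. Passing to the limit at the exit time shows that
  both values are `u` (`exists_strategy_le_expectedPayoff`, `exists_strategy_expectedPayoff_le`).

The delicate point is measurability: that the operator preserves Borel functions, and that nearly
optimal choices can be made in a Borel way. Suprema over open balls are lower semicontinuous in centre
and radius for every bounded function, and points nearly attaining them can be taken from one countable
set (`exists_measurable_near_sSup`). The infimum over `c` is over an uncountable set, and the value of
a round is in general neither lower nor upper semicontinuous in `c`. It is, however, the sum of a part
that is lower semicontinuous in `(x, c)` and a part that is nondecreasing in `c`. Hence replacing `c` by
the least `c'` at which the first part is at most a rational `q` slightly above its value at `c` costs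
almost nothing; these least parameters are Borel functions of `x`, one for each `q`
(`measurable_leastParam`, `exists_rat_roundValue_leastParam_le`), so that countably many Borel choices
suffice (`measurable_Aplus`, `exists_measurable_near_Aplus`).
-/

namespace GamblingHouse

open Filter Topology

/-! ### Suprema, infima and means over balls -/

section Balls

variable {d : ℕ} {φ : Space d → ℝ} {C : ℝ}

theorem bddAbove_image_of_abs_le (hC : ∀ x, |φ x| ≤ C) (s : Set (Space d)) :
    BddAbove (φ '' s) :=
  ⟨C, by rintro _ ⟨x, -, rfl⟩; exact (abs_le.1 (hC x)).2⟩

theorem bddBelow_image_of_abs_le (hC : ∀ x, |φ x| ≤ C) (s : Set (Space d)) :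
    BddBelow (φ '' s) :=
  ⟨-C, by rintro _ ⟨x, -, rfl⟩; exact (abs_le.1 (hC x)).1⟩

theorem sInf_image_neg (φ : Space d → ℝ) (s : Set (Space d)) :
    sInf ((-φ) '' s) = -sSup (φ '' s) := by
  rw [← Real.sInf_neg, ← Set.image_neg_eq_neg, Set.image_image]
  rfl

theorem sSup_image_neg (φ : Space d → ℝ) (s : Set (Space d)) :
    sSup ((-φ) '' s) = -sInf (φ '' s) := by
  have h := sInf_image_neg (-φ) s
  rw [neg_neg] at h
  linarith

theorem lt_sSup_image_ball_iff (hC : ∀ x, |φ x| ≤ C) {x : Space d} {r t : ℝ} (hr : 0 < r) :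
    t < sSup (φ '' ball x r) ↔ ∃ y, dist y x < r ∧ t < φ y := by
  rw [lt_csSup_iff (bddAbove_image_of_abs_le hC _) ((nonempty_ball.2 hr).image φ)]
  simp [mem_ball]

/-- The supremum of an arbitrary bounded function over an open ball is lower semicontinuous in the
centre and the radius, because membership in an open ball is an open condition. -/
theorem eventually_lt_sSup_image_ball (hC : ∀ x, |φ x| ≤ C) {x : Space d} {r t : ℝ} (hr : 0 < r)
    (ht : t < sSup (φ '' ball x r)) :
    ∀ᶠ q : Space d × ℝ in 𝓝 (x, r), t < sSup (φ '' ball q.1 q.2) := by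
  obtain ⟨y, hy, hty⟩ := (lt_sSup_image_ball_iff hC hr).1 ht
  have h1 : ∀ᶠ q : Space d × ℝ in 𝓝 (x, r), dist y q.1 < q.2 :=
    (isOpen_lt (by fun_prop) (by fun_prop)).mem_nhds hy
  filter_upwards [h1] with q hq
  exact (lt_sSup_image_ball_iff hC (dist_nonneg.trans_lt hq)).2 ⟨y, hq, hty⟩

theorem measurable_sSup_image_ball (hC : ∀ x, |φ x| ≤ C) :
    Measurable fun q : Space d × ℝ => sSup (φ '' ball q.1 q.2) := by
  refine measurable_of_Ioi fun t => ?_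
  -- For `r ≤ 0` the ball is empty and the supremum is `sSup ∅ = 0`.
  have e : (fun q : Space d × ℝ => sSup (φ '' ball q.1 q.2)) ⁻¹' Set.Ioi t =
      {q | 0 < q.2 ∧ t < sSup (φ '' ball q.1 q.2)} ∪ {q | q.2 ≤ 0 ∧ t < 0} := by
    ext q
    rcases lt_or_ge 0 q.2 with h | h
    · simp [h]
    · simp [h, ball_eq_empty.2 h, not_lt.2 h]
  rw [e]
  refine MeasurableSet.union (IsOpen.measurableSet ?_)
    ((measurableSet_le measurable_snd measurable_const).inter (MeasurableSet.const _))
  rw [isOpen_iff_mem_nhds]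
  rintro ⟨x, r⟩ ⟨hr, ht⟩
  have h1 : ∀ᶠ q : Space d × ℝ in 𝓝 (x, r), 0 < q.2 :=
    (isOpen_lt continuous_const continuous_snd).mem_nhds hr
  exact h1.and (eventually_lt_sSup_image_ball hC hr ht)

theorem measurable_sInf_image_ball (hC : ∀ x, |φ x| ≤ C) :
    Measurable fun q : Space d × ℝ => sInf (φ '' ball q.1 q.2) := by
  have h := measurable_sSup_image_ball (φ := -φ) (C := C) (by simpa using hC)
  simp only [sSup_image_neg] at h
  exact measurable_neg_iff.1 h

theorem integrable_of_abs_le {X : Type*} [MeasurableSpace X] {μ : Measure X} [IsFiniteMeasure μ]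
    {ψ : X → ℝ} {C : ℝ} (hψ : Measurable ψ) (hC : ∀ x, |ψ x| ≤ C) : Integrable ψ μ :=
  Integrable.of_bound hψ.aestronglyMeasurable C (Eventually.of_forall hC)

theorem setAverage_eq_integral_cond (φ : Space d → ℝ) (s : Set (Space d)) :
    ⨍ y in s, φ y = ∫ y, φ y ∂(ProbabilityTheory.cond (volume : Measure (Space d)) s) := by
  rw [average_eq', Measure.restrict_apply_univ]
  rfl

theorem isProbabilityMeasure_cond_ball (x : Space d) {r : ℝ} (hr : 0 < r) :
    IsProbabilityMeasure (ProbabilityTheory.cond (volume : Measure (Space d)) (ball x r)) :=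
  cond_isProbabilityMeasure_of_finite (measure_ball_pos _ _ hr).ne' measure_ball_lt_top.ne

theorem measurable_setAverage_ball (hφ : Measurable φ) :
    Measurable fun q : Space d × ℝ => ⨍ y in ball q.1 q.2, φ y := by
  let κ : Kernel (Space d × ℝ) (Space d) :=
    ⟨fun q => ProbabilityTheory.cond volume (ball q.1 q.2),
      measurable_cond_ball measurable_fst measurable_snd⟩
  have : IsFiniteKernel κ := by
    refine ⟨1, ENNReal.one_lt_top, fun q => ?_⟩
    change ProbabilityTheory.cond volume (ball q.1 q.2) Set.univ ≤ 1
    rw [cond_apply measurableSet_ball, Set.inter_univ]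
    exact ENNReal.inv_mul_le_one _
  simp only [setAverage_eq_integral_cond]
  exact (hφ.stronglyMeasurable.integral_kernel (κ := κ)).measurable

theorem continuousAt_setIntegral_ball (hφ : Measurable φ) (hC : ∀ x, |φ x| ≤ C) (x : Space d)
    {r : ℝ} (hr : 0 < r) :
    ContinuousAt (fun q : Space d × ℝ => ∫ y in ball q.1 q.2, φ y) (x, r) := by
  have hC0 : 0 ≤ C := (abs_nonneg _).trans (hC 0)
  simp only [← integral_indicator measurableSet_ball]
  have hlim : ∀ᵐ y : Space d, Tendsto (fun q : Space d × ℝ => (ball q.1 q.2).indicator φ y)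
      (𝓝 (x, r)) (𝓝 ((ball x r).indicator φ y)) := by
    have hs : (volume : Measure (Space d)) (sphere x r) = 0 :=
      Measure.addHaar_sphere_of_ne_zero _ _ hr.ne'
    filter_upwards [measure_eq_zero_iff_ae_notMem.1 hs] with y hy
    refine tendsto_const_nhds.congr' ?_
    rcases lt_or_gt_of_ne (mem_sphere.not.1 hy) with h | h
    · have h1 : ∀ᶠ q : Space d × ℝ in 𝓝 (x, r), dist y q.1 < q.2 :=
        (isOpen_lt (by fun_prop) (by fun_prop)).mem_nhds h
      filter_upwards [h1] with q hq
      rw [Set.indicator_of_mem (mem_ball.2 h), Set.indicator_of_mem (mem_ball.2 hq)]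
    · have h1 : ∀ᶠ q : Space d × ℝ in 𝓝 (x, r), q.2 < dist y q.1 :=
        (isOpen_lt (by fun_prop) (by fun_prop)).mem_nhds h
      filter_upwards [h1] with q hq
      rw [Set.indicator_of_notMem (by simpa using h.le),
        Set.indicator_of_notMem (by simpa using hq.le)]
  have hbd : ∀ᶠ q : Space d × ℝ in 𝓝 (x, r), ball q.1 q.2 ⊆ ball x (r + 2) := by
    have h1 : ∀ᶠ q : Space d × ℝ in 𝓝 (x, r), dist q.1 x < 1 :=
      (isOpen_lt (by fun_prop) (by fun_prop)).mem_nhds (by simp)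
    have h2 : ∀ᶠ q : Space d × ℝ in 𝓝 (x, r), q.2 < r + 1 :=
      (isOpen_lt (by fun_prop) (by fun_prop)).mem_nhds (by simp)
    filter_upwards [h1, h2] with q hq1 hq2
    exact ball_subset_ball' (by linarith)
  refine tendsto_integral_filter_of_dominated_convergence
    ((ball x (r + 2)).indicator fun _ => C)
    (Eventually.of_forall fun q => (hφ.indicator measurableSet_ball).aestronglyMeasurable) ?_ ?_ hlim
  · filter_upwards [hbd] with q hq
    refine Eventually.of_forall fun y => ?_
    by_cases hy : y ∈ ball q.1 q.2
    · rw [Set.indicator_of_mem hy, Set.indicator_of_mem (hq hy)]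
      exact hC y
    · rw [Set.indicator_of_notMem hy, norm_zero]
      exact Set.indicator_nonneg (fun _ _ => hC0) _
  · exact (integrable_indicator_iff measurableSet_ball).2
      (integrableOn_const measure_ball_lt_top.ne)

theorem continuousAt_setAverage_ball (hφ : Measurable φ) (hC : ∀ x, |φ x| ≤ C) (x : Space d)
    {r : ℝ} (hr : 0 < r) :
    ContinuousAt (fun q : Space d × ℝ => ⨍ y in ball q.1 q.2, φ y) (x, r) := by
  have h1 := continuousAt_setIntegral_ball (φ := fun _ => (1 : ℝ)) (C := 1) measurable_const
    (by simp) x hr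
  simp only [setIntegral_const, smul_eq_mul, mul_one] at h1
  simp only [setAverage_eq, smul_eq_mul]
  exact (h1.inv₀ (ENNReal.toReal_pos (measure_ball_pos _ _ hr).ne'
    measure_ball_lt_top.ne).ne').mul (continuousAt_setIntegral_ball hφ hC x hr)

/-- A Borel selector of nearly maximal points in balls. The values of `φ` are approached along a
fixed countable set, a union of dense subsets of the superlevel sets of `φ` at rational levels;
the selector picks the first good point of an enumeration of this set. -/
theorem exists_measurable_near_sSup (hC : ∀ x, |φ x| ≤ C) {η : ℝ}
    (hη : 0 < η) :
    ∃ σ : Space d × ℝ → Space d, Measurable σ ∧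
      ∀ x r, 0 < r → σ (x, r) ∈ ball x r ∧ sSup (φ '' ball x r) - η < φ (σ (x, r)) := by
  classical
  have hD : ∀ q : ℚ, ∃ D : Set (Space d), D ⊆ {y | (q : ℝ) < φ y} ∧ D.Countable ∧
      {y | (q : ℝ) < φ y} ⊆ closure D := fun q =>
    (TopologicalSpace.IsSeparable.of_separableSpace _).exists_countable_dense_subset
  choose D hDsub hDc hDd using hD
  have hc : (insert (0 : Space d) (⋃ q, D q)).Countable := (Set.countable_iUnion hDc).insert _
  obtain ⟨e, he⟩ := hc.exists_eq_range ⟨_, Set.mem_insert _ _⟩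
  -- The clause `q.2 ≤ 0` makes the search succeed for empty balls too.
  let P : ℕ → Space d × ℝ → Prop := fun n q =>
    q.2 ≤ 0 ∨ (dist (e n) q.1 < q.2 ∧ sSup (φ '' ball q.1 q.2) - η < φ (e n))
  have hP : ∀ q, ∃ n, P n q := by
    rintro ⟨x, r⟩
    rcases le_or_gt r 0 with hr | hr
    · exact ⟨0, Or.inl hr⟩
    obtain ⟨t, ht1, ht2⟩ := exists_rat_btwn (sub_lt_self (sSup (φ '' ball x r)) hη)
    obtain ⟨y, hy, hty⟩ := (lt_sSup_image_ball_iff hC hr).1 ht2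
    obtain ⟨z, hz, hzD⟩ := mem_closure_iff.1 (hDd t hty) (ball x r) isOpen_ball hy
    have hz' : z ∈ Set.range e := he ▸ Set.mem_insert_of_mem _ (Set.mem_iUnion.2 ⟨t, hzD⟩)
    obtain ⟨n, rfl⟩ := hz'
    exact ⟨n, Or.inr ⟨hz, ht1.trans (hDsub t hzD)⟩⟩
  have hPm : ∀ n, MeasurableSet {q | P n q} := fun n =>
    (measurableSet_le measurable_snd measurable_const).union
      ((measurableSet_lt (measurable_const.dist measurable_fst) measurable_snd).inter
        (measurableSet_lt ((measurable_sSup_image_ball hC).sub_const η) measurable_const))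
  refine ⟨fun q => e (Nat.find (hP q)),
    Measurable.find (f := fun n _ => e n) (fun n => measurable_const) hPm hP, fun x r hr => ?_⟩
  exact (Nat.find_spec (hP (x, r))).resolve_left (not_le.2 hr)

end Balls

/-! ### One round of the game -/

section Round

variable {d : ℕ} {p ε : ℝ} {φ ψ : Space d → ℝ} {C c : ℝ}

theorem cMin_pos (hε : 0 < ε) : 0 < cMin p ε := Real.rpow_pos_of_pos hε _

theorem cMin_le_cMax (hp : 2 < p) (hε : 0 < ε) (hε1 : ε ≤ 1) : cMin p ε ≤ cMax p ε := by
  have h0 := alpha_pos hp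
  have h1 := alpha_lt_one hp
  refine (Real.rpow_le_one hε.le hε1 ?_).trans (Real.one_le_rpow_of_pos_of_le_one_of_nonpos hε hε1 ?_)
  · positivity
  · have : 0 < 2 - alpha p := by linarith
    rw [neg_nonpos]; positivity

theorem jumpRadius_pos (hε : 0 < ε) (hc : 0 < c) : 0 < jumpRadius p ε c := by
  unfold jumpRadius; positivity

theorem jumpRadius_mono (hp : 2 < p) {c' : ℝ} (hc : 0 < c) (h : c ≤ c') :
    jumpRadius p ε c ≤ jumpRadius p ε c' := by
  unfold jumpRadius
  exact mul_le_mul_of_nonneg_left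
    (Real.rpow_le_rpow hc.le h (by linarith [alpha_lt_one hp])) (sq_nonneg _)

theorem gamma_pos (hp : 2 < p) : 0 < gamma p d := by unfold gamma; positivity

theorem tugRadius_anti (hp : 2 < p) (hε : 0 < ε) {c' : ℝ} (hc : 0 < c) (h : c ≤ c') :
    tugRadius p d ε c' ≤ tugRadius p d ε c := by
  unfold tugRadius
  refine mul_le_mul_of_nonneg_left (mul_le_mul_of_nonneg_left ?_ hε.le) (gamma_pos hp).le
  exact Real.rpow_le_rpow_of_nonpos hc h (by linarith [alpha_pos hp])

theorem measurable_jumpRadius : Measurable (jumpRadius p ε) := by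
  unfold jumpRadius; fun_prop

theorem measurable_tugRadius : Measurable (tugRadius p d ε) := by
  unfold tugRadius; fun_prop

theorem continuousAt_tugRadius (hc : 0 < c) : ContinuousAt (tugRadius p d ε) c := by
  unfold tugRadius
  exact continuousAt_const.mul (continuousAt_const.mul
    (continuousAt_id.rpow_const (Or.inl hc.ne')))

/-- The value, for a maximizing player, of a round from `x` in which the opponent has selected `c`
and the payoff is `φ` at the next position. -/
noncomputable def roundValue (p : ℝ) {d : ℕ} (ε : ℝ) (φ : Space d → ℝ) (x : Space d) (c : ℝ) : ℝ :=
  alpha p * sSup (φ '' ball x (jumpRadius p ε c))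
    + (1 - alpha p) * tugMean p (ε * c ^ (-(alpha p / 2))) φ x

theorem roundValue_eq (φ : Space d → ℝ) (x : Space d) (c : ℝ) :
    roundValue p ε φ x c = alpha p * sSup (φ '' ball x (jumpRadius p ε c))
      + (1 - alpha p) * (beta p d * ((1 / 2) * sSup (φ '' ball x (tugRadius p d ε c))
        + (1 / 2) * sInf (φ '' ball x (tugRadius p d ε c)))
        + (1 - beta p d) * ⨍ y in ball x (tugRadius p d ε c), φ y) := rfl

theorem Aplus_eq (φ : Space d → ℝ) (x : Space d) :
    Aplus p ε φ x = sInf (roundValue p ε φ x '' Set.Icc (cMin p ε) (cMax p ε)) := rfl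

/-- The two operators are exchanged by changing the sign of the function. -/
theorem Aminus_eq (φ : Space d → ℝ) (x : Space d) :
    Aminus p ε φ x = -Aplus p ε (-φ) x := by
  rw [Aplus_eq, ← Real.sSup_neg, ← Set.image_neg_eq_neg, Set.image_image]
  unfold Aminus
  congr 1
  refine Set.image_congr fun c _ => ?_
  have h : ∀ s : Set (Space d), ⨍ y in s, (-φ) y = -⨍ y in s, φ y := fun s => average_neg _ _
  simp only [roundValue, tugMean, sSup_image_neg, sInf_image_neg, h]
  ring

theorem integral_roundLaw (hp : 2 < p) (hε : 0 < ε) (hc : cMin p ε ≤ c) (hφ : Measurable φ)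
    (hC : ∀ x, |φ x| ≤ C) (x y z₁ z₂ : Space d) :
    ∫ w, φ w ∂(roundLaw p ε c x y z₁ z₂) = alpha p * φ y
      + (1 - alpha p) * (beta p d * ((1 / 2) * φ z₁ + (1 / 2) * φ z₂)
        + (1 - beta p d) * ⨍ y in ball x (tugRadius p d ε c), φ y) := by
  have := isProbabilityMeasure_cond_ball x (tugRadius_pos (d := d) hp hε hc)
  have hi : ∀ μ : Measure (Space d), ∀ [IsFiniteMeasure μ], Integrable φ μ :=
    fun μ _ => integrable_of_abs_le hφ hC
  have ha := alpha_pos hp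
  have ha1 := alpha_lt_one hp
  have hb := beta_pos (d := d) hp
  have hb1 := beta_lt_one (d := d) hp
  have fin : ∀ (a : ℝ) (μ : Measure (Space d)), ∀ [IsFiniteMeasure μ],
      IsFiniteMeasure (ENNReal.ofReal a • μ) := fun a μ _ => μ.smul_finite ENNReal.ofReal_ne_top
  have f1 := fin (alpha p) (Measure.dirac y)
  have f2 := fin (1 / 2) (Measure.dirac z₁)
  have f3 := fin (1 / 2) (Measure.dirac z₂)
  have f4 := fin (beta p d) (ENNReal.ofReal (1 / 2) • Measure.dirac z₁
    + ENNReal.ofReal (1 / 2) • Measure.dirac z₂)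
  have f5 := fin (1 - beta p d)
    (ProbabilityTheory.cond (volume : Measure (Space d)) (ball x (tugRadius p d ε c)))
  have f6 := fin (1 - alpha p) (ENNReal.ofReal (beta p d) •
          (ENNReal.ofReal (1 / 2) • Measure.dirac z₁ + ENNReal.ofReal (1 / 2) • Measure.dirac z₂)
        + ENNReal.ofReal (1 - beta p d) • ProbabilityTheory.cond volume (ball x (tugRadius p d ε c)))
  unfold roundLaw
  rw [integral_add_measure (hi _) (hi _), integral_smul_measure, integral_smul_measure,
    integral_add_measure (hi _) (hi _), integral_smul_measure, integral_smul_measure,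
    integral_add_measure (hi _) (hi _), integral_smul_measure, integral_smul_measure,
    integral_dirac, integral_dirac, integral_dirac, setAverage_eq_integral_cond,
    ENNReal.toReal_ofReal ha.le, ENNReal.toReal_ofReal (sub_nonneg.2 ha1.le), ENNReal.toReal_ofReal hb.le,
    ENNReal.toReal_ofReal (sub_nonneg.2 hb1.le), ENNReal.toReal_ofReal (by norm_num)]
  simp only [smul_eq_mul]

theorem roundLaw_comm (c : ℝ) (x y z₁ z₂ : Space d) :
    roundLaw p ε c x y z₁ z₂ = roundLaw p ε c x y z₂ z₁ := by
  unfold roundLaw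
  rw [add_comm (ENNReal.ofReal (1 / 2) • Measure.dirac z₁)]

/-- Moves of the maximizing player that are optimal up to `η` secure the value of the round up
to `η`. -/
theorem roundValue_sub_le_integral (hp : 2 < p) (hε : 0 < ε) (hc : cMin p ε ≤ c)
    (hφ : Measurable φ) (hC : ∀ x, |φ x| ≤ C) {η : ℝ} (hη : 0 ≤ η) {x y z₁ z₂ : Space d}
    (hy : sSup (φ '' ball x (jumpRadius p ε c)) - η ≤ φ y)
    (hz₁ : sSup (φ '' ball x (tugRadius p d ε c)) - η ≤ φ z₁)
    (hz₂ : z₂ ∈ ball x (tugRadius p d ε c)) :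
    roundValue p ε φ x c - η ≤ ∫ w, φ w ∂(roundLaw p ε c x y z₁ z₂) := by
  rw [integral_roundLaw hp hε hc hφ hC, roundValue_eq]
  have h2 : sInf (φ '' ball x (tugRadius p d ε c)) ≤ φ z₂ :=
    csInf_le (bddBelow_image_of_abs_le hC _) ⟨_, hz₂, rfl⟩
  have ha := alpha_pos hp
  have ha1 : 0 < 1 - alpha p := sub_pos.2 (alpha_lt_one hp)
  have hb := beta_pos (d := d) hp
  have hb1 := beta_lt_one (d := d) hp
  have e1 := mul_le_mul_of_nonneg_left hy ha.le
  have e2 := mul_le_mul_of_nonneg_left (add_le_add hz₁ h2) (mul_pos ha1 hb).le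
  have e3 : (1 - alpha p) * beta p d * η ≤ (1 - alpha p) * (2 * η) := by
    rw [mul_assoc]
    exact mul_le_mul_of_nonneg_left (by nlinarith) ha1.le
  linarith

/-- Moves of the minimizing player in tug-of-war that are optimal up to `η` secure the value of
the round up to `η`. -/
theorem integral_le_roundValue_add (hp : 2 < p) (hε : 0 < ε) (hc : cMin p ε ≤ c)
    (hφ : Measurable φ) (hC : ∀ x, |φ x| ≤ C) {η : ℝ} (hη : 0 ≤ η) {x y z₁ z₂ : Space d}
    (hy : y ∈ ball x (jumpRadius p ε c)) (hz₁ : z₁ ∈ ball x (tugRadius p d ε c))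
    (hz₂ : φ z₂ ≤ sInf (φ '' ball x (tugRadius p d ε c)) + η) :
    ∫ w, φ w ∂(roundLaw p ε c x y z₁ z₂) ≤ roundValue p ε φ x c + η := by
  rw [integral_roundLaw hp hε hc hφ hC, roundValue_eq]
  have h1 : φ y ≤ sSup (φ '' ball x (jumpRadius p ε c)) :=
    le_csSup (bddAbove_image_of_abs_le hC _) ⟨_, hy, rfl⟩
  have h2 : φ z₁ ≤ sSup (φ '' ball x (tugRadius p d ε c)) :=
    le_csSup (bddAbove_image_of_abs_le hC _) ⟨_, hz₁, rfl⟩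
  have ha := alpha_pos hp
  have ha1 : 0 < 1 - alpha p := sub_pos.2 (alpha_lt_one hp)
  have hb := beta_pos (d := d) hp
  have hb1 := beta_lt_one (d := d) hp
  have e1 := mul_le_mul_of_nonneg_left h1 ha.le
  have e2 := mul_le_mul_of_nonneg_left (add_le_add h2 hz₂) (mul_pos ha1 hb).le
  have e3 : (1 - alpha p) * (beta p d * η) ≤ 1 * (1 * η) :=
    mul_le_mul (by linarith) (mul_le_mul_of_nonneg_right hb1.le hη) (by positivity) (by norm_num)
  linarith [mul_nonneg (mul_pos ha1 hb).le hη]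

/-- If one round from `x` adds at most `k` to `χ` in the mean, whatever the moves, then adding `χ`
to the payoff adds at most `k` to the value of the round. -/
theorem roundValue_le_add (hp : 2 < p) (hε : 0 < ε) (hc : cMin p ε ≤ c) {χ : Space d → ℝ}
    {Cφ Cψ Cχ k : ℝ} (hφ : Measurable φ) (hCφ : ∀ x, |φ x| ≤ Cφ) (hψ : Measurable ψ)
    (hCψ : ∀ x, |ψ x| ≤ Cψ) (hχ : Measurable χ) (hCχ : ∀ x, |χ x| ≤ Cχ)
    (hle : ∀ x, φ x ≤ ψ x + χ x) {x : Space d}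
    (hk : ∀ y z₁ z₂, ∫ w, χ w ∂(roundLaw p ε c x y z₁ z₂) ≤ k) :
    roundValue p ε φ x c ≤ roundValue p ε ψ x c + k := by
  have hc0 : 0 < c := (cMin_pos hε).trans_le hc
  have hj : (ball x (jumpRadius p ε c)).Nonempty := nonempty_ball.2 (jumpRadius_pos hε hc0)
  have ht : (ball x (tugRadius p d ε c)).Nonempty := nonempty_ball.2 (tugRadius_pos hp hε hc)
  refine le_of_forall_pos_le_add fun η hη => ?_
  have hη2 : 0 < η / 2 := half_pos hη
  obtain ⟨_, ⟨y, hy, rfl⟩, hy'⟩ := exists_lt_of_lt_csSup (hj.image φ) (sub_lt_self _ hη2)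
  obtain ⟨_, ⟨z₁, hz₁, rfl⟩, hz₁'⟩ := exists_lt_of_lt_csSup (ht.image φ) (sub_lt_self _ hη2)
  obtain ⟨_, ⟨z₂, hz₂, rfl⟩, hz₂'⟩ := exists_lt_of_csInf_lt (ht.image ψ) (lt_add_of_pos_right _ hη2)
  have := isProbabilityMeasure_roundLaw hp hε hc x y z₁ z₂
  have h1 := roundValue_sub_le_integral hp hε hc hφ hCφ hη2.le hy'.le hz₁'.le hz₂
  have h2 := integral_le_roundValue_add hp hε hc hψ hCψ hη2.le hy hz₁ hz₂'.le
  have h3 : ∫ w, φ w ∂(roundLaw p ε c x y z₁ z₂) ≤ ∫ w, (ψ w + χ w) ∂(roundLaw p ε c x y z₁ z₂) :=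
    integral_mono (integrable_of_abs_le hφ hCφ)
      ((integrable_of_abs_le hψ hCψ).add (integrable_of_abs_le hχ hCχ)) hle
  rw [integral_add (integrable_of_abs_le hψ hCψ) (integrable_of_abs_le hχ hCχ)] at h3
  linarith [hk y z₁ z₂]

theorem abs_roundValue_le (hp : 2 < p) (hε : 0 < ε) (hc : cMin p ε ≤ c) (hφ : Measurable φ)
    (hC : ∀ x, |φ x| ≤ C) (x : Space d) : |roundValue p ε φ x c| ≤ C := by
  have hlaw : ∀ k : ℝ, ∀ y z₁ z₂, ∫ _, k ∂(roundLaw p ε c x y z₁ z₂) ≤ k := by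
    intro k y z₁ z₂
    have := isProbabilityMeasure_roundLaw hp hε hc x y z₁ z₂
    simp
  have hzero : roundValue p ε (fun _ : Space d => (0 : ℝ)) x c = 0 := by
    have hj : (ball x (jumpRadius p ε c)).Nonempty :=
      nonempty_ball.2 (jumpRadius_pos hε ((cMin_pos hε).trans_le hc))
    have ht : (ball x (tugRadius p d ε c)).Nonempty := nonempty_ball.2 (tugRadius_pos hp hε hc)
    simp [roundValue_eq, hj.image_const, ht.image_const]
  have h0 : ∀ _ : Space d, |(0 : ℝ)| ≤ 0 := fun _ => abs_zero.le
  have h1 := roundValue_le_add (x := x) hp hε hc hφ hC (measurable_const (a := (0 : ℝ))) h0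
    (measurable_const (a := C)) (fun _ => le_rfl)
    (fun y => by rw [zero_add]; exact (abs_le.1 (hC y)).2) (hlaw C)
  have h2 := roundValue_le_add (x := x) hp hε hc (measurable_const (a := (0 : ℝ))) h0 hφ hC
    (measurable_const (a := C)) (fun _ => le_rfl)
    (fun y => by linarith [(abs_le.1 (hC y)).1]) (hlaw C)
  rw [abs_le]
  constructor <;> linarith

end Round

/-! ### The operators of the dynamic programming principle -/

section Operators

variable {d : ℕ} {p ε : ℝ} {φ ψ : Space d → ℝ} {C : ℝ}

theorem bddBelow_roundValue (hp : 2 < p) (hε : 0 < ε) (hφ : Measurable φ)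
    (hC : ∀ x, |φ x| ≤ C) (x : Space d) :
    BddBelow (roundValue p ε φ x '' Set.Icc (cMin p ε) (cMax p ε)) :=
  ⟨-C, by rintro _ ⟨c, hc, rfl⟩; exact (abs_le.1 (abs_roundValue_le hp hε hc.1 hφ hC x)).1⟩

theorem Aplus_le_roundValue (hp : 2 < p) (hε : 0 < ε) (hφ : Measurable φ)
    (hC : ∀ x, |φ x| ≤ C) (x : Space d) {c : ℝ} (hc : c ∈ Set.Icc (cMin p ε) (cMax p ε)) :
    Aplus p ε φ x ≤ roundValue p ε φ x c :=
  csInf_le (bddBelow_roundValue hp hε hφ hC x) ⟨c, hc, rfl⟩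

theorem Aplus_le_add (hp : 2 < p) (hε : 0 < ε) (hε1 : ε ≤ 1) {χ : Space d → ℝ}
    {Cφ Cψ Cχ k : ℝ} (hφ : Measurable φ) (hCφ : ∀ x, |φ x| ≤ Cφ) (hψ : Measurable ψ)
    (hCψ : ∀ x, |ψ x| ≤ Cψ) (hχ : Measurable χ) (hCχ : ∀ x, |χ x| ≤ Cχ)
    (hle : ∀ x, φ x ≤ ψ x + χ x) {x : Space d}
    (hk : ∀ c ∈ Set.Icc (cMin p ε) (cMax p ε), ∀ y z₁ z₂,
      ∫ w, χ w ∂(roundLaw p ε c x y z₁ z₂) ≤ k) :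
    Aplus p ε φ x ≤ Aplus p ε ψ x + k := by
  rw [← sub_le_iff_le_add]
  refine le_csInf ((Set.nonempty_Icc.2 (cMin_le_cMax hp hε hε1)).image _) ?_
  rintro _ ⟨c, hc, rfl⟩
  have h1 := Aplus_le_roundValue hp hε hφ hCφ x hc
  have h2 := roundValue_le_add hp hε hc.1 hφ hCφ hψ hCψ hχ hCχ hle (hk c hc)
  change _ ≤ roundValue p ε ψ x c
  linarith

theorem Aminus_le_add (hp : 2 < p) (hε : 0 < ε) (hε1 : ε ≤ 1) {χ : Space d → ℝ}
    {Cφ Cψ Cχ k : ℝ} (hφ : Measurable φ) (hCφ : ∀ x, |φ x| ≤ Cφ) (hψ : Measurable ψ)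
    (hCψ : ∀ x, |ψ x| ≤ Cψ) (hχ : Measurable χ) (hCχ : ∀ x, |χ x| ≤ Cχ)
    (hle : ∀ x, φ x ≤ ψ x + χ x) {x : Space d}
    (hk : ∀ c ∈ Set.Icc (cMin p ε) (cMax p ε), ∀ y z₁ z₂,
      ∫ w, χ w ∂(roundLaw p ε c x y z₁ z₂) ≤ k) :
    Aminus p ε φ x ≤ Aminus p ε ψ x + k := by
  have h := Aplus_le_add hp hε hε1 (φ := -ψ) (ψ := -φ) hψ.neg (by simpa using hCψ) hφ.neg
    (by simpa using hCφ) hχ hCχ (fun y => by simp only [Pi.neg_apply]; linarith [hle y]) hk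
  rw [Aminus_eq, Aminus_eq]
  linarith

theorem abs_Aplus_le (hp : 2 < p) (hε : 0 < ε) (hε1 : ε ≤ 1) (hφ : Measurable φ)
    (hC : ∀ x, |φ x| ≤ C) (x : Space d) : |Aplus p ε φ x| ≤ C := by
  have hne := Set.nonempty_Icc.2 (cMin_le_cMax hp hε hε1)
  obtain ⟨c, hc⟩ := hne
  refine abs_le.2 ⟨le_csInf (Set.Nonempty.image _ ⟨c, hc⟩) ?_,
    (Aplus_le_roundValue hp hε hφ hC x hc).trans (abs_le.1 (abs_roundValue_le hp hε hc.1 hφ hC x)).2⟩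
  rintro _ ⟨c, hc, rfl⟩
  exact (abs_le.1 (abs_roundValue_le hp hε hc.1 hφ hC x)).1

/-- The part of `roundValue` that is lower semicontinuous in `c` and `x`; the rest is nondecreasing
in `c`. -/
noncomputable def lscPart (p : ℝ) {d : ℕ} (ε : ℝ) (φ : Space d → ℝ) (x : Space d) (c : ℝ) : ℝ :=
  (1 - alpha p) * (beta p d * ((1 / 2) * sSup (φ '' ball x (tugRadius p d ε c)))
    + (1 - beta p d) * ⨍ y in ball x (tugRadius p d ε c), φ y)

theorem eventually_lt_lscPart (hp : 2 < p) (hε : 0 < ε) (hφ : Measurable φ) (hC : ∀ x, |φ x| ≤ C)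
    {x : Space d} {c q : ℝ} (hc : cMin p ε ≤ c) (hq : q < lscPart p ε φ x c) :
    ∀ᶠ z : Space d × ℝ in 𝓝 (x, c), q < lscPart p ε φ z.1 z.2 := by
  have hr := tugRadius_pos (d := d) hp hε hc
  have hc0 : 0 < c := (cMin_pos hε).trans_le hc
  have ht : Tendsto (fun z : Space d × ℝ => (z.1, tugRadius p d ε z.2)) (𝓝 (x, c))
      (𝓝 (x, tugRadius p d ε c)) :=
    continuousAt_fst.prodMk (ContinuousAt.comp (f := Prod.snd) (g := tugRadius p d ε)
      (continuousAt_tugRadius hc0) continuousAt_snd)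
  have ha1 : 0 < 1 - alpha p := sub_pos.2 (alpha_lt_one hp)
  have hb := beta_pos (d := d) hp
  have hb1 : 0 < 1 - beta p d := sub_pos.2 (beta_lt_one (d := d) hp)
  obtain ⟨η, hη, hqη⟩ : ∃ η > 0, q + η < lscPart p ε φ x c :=
    ⟨(lscPart p ε φ x c - q) / 2, by linarith, by linarith⟩
  have e1 : ∀ᶠ z : Space d × ℝ in 𝓝 (x, c), sSup (φ '' ball x (tugRadius p d ε c)) - η <
      sSup (φ '' ball z.1 (tugRadius p d ε z.2)) :=
    ht.eventually (eventually_lt_sSup_image_ball hC hr (sub_lt_self _ hη))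
  have e2 : ∀ᶠ z : Space d × ℝ in 𝓝 (x, c), (⨍ y in ball x (tugRadius p d ε c), φ y) - η <
      ⨍ y in ball z.1 (tugRadius p d ε z.2), φ y :=
    ht.eventually ((continuousAt_setAverage_ball hφ hC x hr).eventually_const_lt
      (sub_lt_self _ hη))
  filter_upwards [e1, e2] with z h1 h2
  have h3 := mul_le_mul_of_nonneg_left h1.le (mul_pos ha1 hb).le
  have h4 := mul_le_mul_of_nonneg_left h2.le (mul_pos ha1 hb1).le
  have h5 : (1 - alpha p) * beta p d * η ≤ (1 - alpha p) * beta p d * (2 * η) :=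
    mul_le_mul_of_nonneg_left (by linarith) (mul_pos ha1 hb).le
  have h6 : (1 - alpha p) * η ≤ 1 * η := mul_le_mul_of_nonneg_right (by linarith [alpha_pos hp]) hη.le
  unfold lscPart at hqη ⊢
  linarith

/-- The least `c` at which `lscPart` is at most `q`, with the value `M(ε)` if there is none. -/
noncomputable def leastParam (p : ℝ) {d : ℕ} (ε : ℝ) (φ : Space d → ℝ) (q : ℝ) (x : Space d) : ℝ :=
  sInf ({c | c ∈ Set.Icc (cMin p ε) (cMax p ε) ∧ lscPart p ε φ x c ≤ q} ∪ {cMax p ε})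

theorem leastParam_mem (hp : 2 < p) (hε : 0 < ε) (hε1 : ε ≤ 1) (q : ℝ) (x : Space d) :
    leastParam p ε φ q x ∈ Set.Icc (cMin p ε) (cMax p ε) := by
  have hb : ∀ c ∈ {c | c ∈ Set.Icc (cMin p ε) (cMax p ε) ∧ lscPart p ε φ x c ≤ q} ∪ {cMax p ε},
      cMin p ε ≤ c := by
    rintro c (hc | rfl)
    · exact hc.1.1
    · exact cMin_le_cMax hp hε hε1
  exact ⟨le_csInf ⟨_, Or.inr rfl⟩ hb, csInf_le ⟨_, hb⟩ (Or.inr rfl)⟩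

theorem leastParam_spec (hp : 2 < p) (hε : 0 < ε) (hφ : Measurable φ)
    (hC : ∀ x, |φ x| ≤ C) {q c : ℝ} {x : Space d} (hc : c ∈ Set.Icc (cMin p ε) (cMax p ε))
    (hq : lscPart p ε φ x c ≤ q) :
    leastParam p ε φ q x ≤ c ∧ lscPart p ε φ x (leastParam p ε φ q x) ≤ q := by
  set S : Set ℝ := {c | c ∈ Set.Icc (cMin p ε) (cMax p ε) ∧ lscPart p ε φ x c ≤ q} with hS
  have hcl : IsClosed S := by
    rw [← isOpen_compl_iff, isOpen_iff_mem_nhds]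
    intro b hb
    by_cases hbI : b ∈ Set.Icc (cMin p ε) (cMax p ε)
    · have hlt : q < lscPart p ε φ x b := not_le.1 fun h => hb ⟨hbI, h⟩
      have ht : Tendsto (fun b : ℝ => (x, b)) (𝓝 b) (𝓝 (x, b)) := by
        exact (Continuous.prodMk_right x).tendsto b
      filter_upwards [ht.eventually (eventually_lt_lscPart hp hε hφ hC hbI.1 hlt)] with b' hb' h
      exact not_le.2 hb' h.2
    · filter_upwards [isClosed_Icc.isOpen_compl.mem_nhds hbI] with b' hb' h
      exact hb' h.1
  have hcpt : IsCompact (S ∪ {cMax p ε}) :=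
    (isCompact_Icc.of_isClosed_subset hcl fun _ h => h.1).union isCompact_singleton
  have hle : leastParam p ε φ q x ≤ c := csInf_le hcpt.bddBelow (Or.inl ⟨hc, hq⟩)
  refine ⟨hle, ?_⟩
  rcases hcpt.sInf_mem ⟨_, Or.inr rfl⟩ with h | h
  · exact h.2
  · have h' : leastParam p ε φ q x = cMax p ε := h
    rwa [h', ← le_antisymm hc.2 (h' ▸ hle)]

/-- The least parameter is a lower semicontinuous function of `x`, since a projection along a
compact interval is closed. -/
theorem measurable_leastParam (hp : 2 < p) (hε : 0 < ε) (hε1 : ε ≤ 1) (hφ : Measurable φ)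
    (hC : ∀ x, |φ x| ≤ C) (q : ℝ) : Measurable (leastParam p ε φ q) := by
  refine measurable_of_Ioi fun t => ?_
  rcases le_or_gt (cMax p ε) t with ht | ht
  · have e : leastParam p ε φ q ⁻¹' Set.Ioi t = ∅ :=
      Set.eq_empty_iff_forall_notMem.2 fun x hx =>
        not_lt.2 ((leastParam_mem hp hε hε1 q x).2.trans ht) hx
    rw [e]
    exact MeasurableSet.empty
  · have e : leastParam p ε φ q ⁻¹' Set.Ioi t =
        {x | ∀ c ∈ Set.Icc (cMin p ε) t, q < lscPart p ε φ x c} := by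
      ext x
      constructor
      · intro hx c hc
        by_contra hcon
        exact absurd (leastParam_spec hp hε hφ hC ⟨hc.1, hc.2.trans ht.le⟩ (not_lt.1 hcon)).1
          (not_le.2 (hc.2.trans_lt hx))
      · intro hx
        change t < leastParam p ε φ q x
        by_contra hcon
        by_cases hex : ∃ c ∈ Set.Icc (cMin p ε) (cMax p ε), lscPart p ε φ x c ≤ q
        · obtain ⟨c, hc, hcq⟩ := hex
          exact absurd (hx _ ⟨(leastParam_mem hp hε hε1 q x).1, not_lt.1 hcon⟩)
            (not_lt.2 (leastParam_spec hp hε hφ hC hc hcq).2)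
        · have : leastParam p ε φ q x = cMax p ε := by
            have he : {c | c ∈ Set.Icc (cMin p ε) (cMax p ε) ∧ lscPart p ε φ x c ≤ q} = ∅ :=
              Set.eq_empty_iff_forall_notMem.2 fun c hc => hex ⟨c, hc⟩
            rw [leastParam, he, Set.empty_union, csInf_singleton]
          linarith
    rw [e]
    refine (isOpen_iff_mem_nhds.2 fun x hx => ?_).measurableSet
    exact isCompact_Icc.eventually_forall_of_forall_eventually
      fun c hc => eventually_lt_lscPart hp hε hφ hC hc.1 (hx c hc)

/-- Lowering `c` lowers the part of `roundValue` that `lscPart` leaves out: the ball of the free move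
shrinks and the ball of tug-of-war grows. Hence the countably many functions `leastParam` at rational
levels exhaust the infimum over `c`. -/
theorem exists_rat_roundValue_leastParam_le (hp : 2 < p) (hε : 0 < ε) (hε1 : ε ≤ 1)
    (hφ : Measurable φ) (hC : ∀ x, |φ x| ≤ C) {x : Space d} {c η : ℝ}
    (hc : c ∈ Set.Icc (cMin p ε) (cMax p ε)) (hη : 0 < η) :
    ∃ q : ℚ, roundValue p ε φ x (leastParam p ε φ q x) < roundValue p ε φ x c + η := by
  obtain ⟨q, hq1, hq2⟩ := exists_rat_btwn (lt_add_of_pos_right (lscPart p ε φ x c) hη)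
  obtain ⟨hle, hval⟩ := leastParam_spec hp hε hφ hC hc hq1.le
  have hm := leastParam_mem (φ := φ) hp hε hε1 q x
  refine ⟨q, ?_⟩
  set b := leastParam p ε φ q x
  have hb0 : 0 < b := (cMin_pos hε).trans_le hm.1
  have h1 : sSup (φ '' ball x (jumpRadius p ε b)) ≤ sSup (φ '' ball x (jumpRadius p ε c)) :=
    csSup_le_csSup (bddAbove_image_of_abs_le hC _)
      ((nonempty_ball.2 (jumpRadius_pos hε hb0)).image _)
      (Set.image_mono (ball_subset_ball (jumpRadius_mono hp hb0 hle)))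
  have h2 : sInf (φ '' ball x (tugRadius p d ε b)) ≤ sInf (φ '' ball x (tugRadius p d ε c)) :=
    csInf_le_csInf (bddBelow_image_of_abs_le hC _)
      ((nonempty_ball.2 (tugRadius_pos hp hε hc.1)).image _)
      (Set.image_mono (ball_subset_ball (tugRadius_anti hp hε hb0 hle)))
  have h3 := mul_le_mul_of_nonneg_left h1 (alpha_pos hp).le
  have h4 := mul_le_mul_of_nonneg_left h2
    (mul_pos (sub_pos.2 (alpha_lt_one hp)) (beta_pos (d := d) hp)).le
  have h5 := hval.trans_lt hq2
  simp only [lscPart] at h5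
  rw [roundValue_eq, roundValue_eq]
  linarith

theorem measurable_roundValue (hφ : Measurable φ) (hC : ∀ x, |φ x| ≤ C) {σ : Space d → ℝ}
    (hσ : Measurable σ) : Measurable fun x => roundValue p ε φ x (σ x) := by
  have hj : Measurable fun x : Space d => (x, jumpRadius p ε (σ x)) :=
    measurable_id.prodMk (measurable_jumpRadius.comp hσ)
  have ht : Measurable fun x : Space d => (x, tugRadius p d ε (σ x)) :=
    measurable_id.prodMk (measurable_tugRadius.comp hσ)
  simp only [roundValue_eq]
  exact (((measurable_sSup_image_ball hC).comp hj).const_mul _).add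
    ((((((measurable_sSup_image_ball hC).comp ht).const_mul _).add
      (((measurable_sInf_image_ball hC).comp ht).const_mul _)).const_mul _).add
        (((measurable_setAverage_ball hφ).comp ht).const_mul _) |>.const_mul _)

theorem measurable_Aplus (hp : 2 < p) (hε : 0 < ε) (hε1 : ε ≤ 1) (hφ : Measurable φ)
    (hC : ∀ x, |φ x| ≤ C) : Measurable (Aplus p ε φ) := by
  refine measurable_of_Iio fun t => ?_
  have e : Aplus p ε φ ⁻¹' Set.Iio t =
      ⋃ q : ℚ, {x | roundValue p ε φ x (leastParam p ε φ q x) < t} := by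
    ext x
    simp only [Set.mem_preimage, Set.mem_Iio, Set.mem_iUnion, Set.mem_ofPred_eq]
    constructor
    · intro h
      obtain ⟨_, ⟨c, hc, rfl⟩, hct⟩ := exists_lt_of_csInf_lt
        ((Set.nonempty_Icc.2 (cMin_le_cMax hp hε hε1)).image _) (Aplus_eq (p := p) φ x ▸ h)
      obtain ⟨q, hq⟩ := exists_rat_roundValue_leastParam_le hp hε hε1 hφ hC hc (sub_pos.2 hct)
      exact ⟨q, by linarith⟩
    · rintro ⟨q, hq⟩
      exact (Aplus_le_roundValue hp hε hφ hC x (leastParam_mem hp hε hε1 q x)).trans_lt hq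
  rw [e]
  exact MeasurableSet.iUnion fun q => measurableSet_lt
    (measurable_roundValue hφ hC (measurable_leastParam hp hε hε1 hφ hC q)) measurable_const

theorem measurable_Aminus (hp : 2 < p) (hε : 0 < ε) (hε1 : ε ≤ 1) (hφ : Measurable φ)
    (hC : ∀ x, |φ x| ≤ C) : Measurable (Aminus p ε φ) := by
  have h : Aminus p ε φ = fun x => -Aplus p ε (-φ) x := funext fun x => Aminus_eq φ x
  rw [h]
  exact (measurable_Aplus hp hε hε1 hφ.neg (by simpa using hC)).neg

/-- A Borel selector of nearly optimal values of `c`. -/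
theorem exists_measurable_near_Aplus (hp : 2 < p) (hε : 0 < ε) (hε1 : ε ≤ 1) (hφ : Measurable φ)
    (hC : ∀ x, |φ x| ≤ C) {η : ℝ} (hη : 0 < η) :
    ∃ σ : Space d → ℝ, Measurable σ ∧ ∀ x, σ x ∈ Set.Icc (cMin p ε) (cMax p ε) ∧
      roundValue p ε φ x (σ x) < Aplus p ε φ x + η := by
  classical
  obtain ⟨e, he⟩ := exists_surjective_nat ℚ
  let P : ℕ → Space d → Prop := fun n x =>
    roundValue p ε φ x (leastParam p ε φ (e n) x) < Aplus p ε φ x + η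
  have hP : ∀ x, ∃ n, P n x := by
    intro x
    obtain ⟨_, ⟨c, hc, rfl⟩, hct⟩ := exists_lt_of_csInf_lt
      ((Set.nonempty_Icc.2 (cMin_le_cMax hp hε hε1)).image (roundValue p ε φ x))
      (lt_add_of_pos_right _ (half_pos hη))
    obtain ⟨q, hq⟩ := exists_rat_roundValue_leastParam_le hp hε hε1 hφ hC (x := x) hc (half_pos hη)
    obtain ⟨n, rfl⟩ := he q
    rw [← Aplus_eq] at hct
    exact ⟨n, by change _ < _; linarith⟩
  have hL := fun n => measurable_leastParam hp hε hε1 hφ hC (e n : ℝ)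
  have hPm : ∀ n, MeasurableSet {x | P n x} := fun n =>
    measurableSet_lt (measurable_roundValue hφ hC (hL n))
      ((measurable_Aplus hp hε hε1 hφ hC).add_const η)
  exact ⟨fun x => leastParam p ε φ (e (Nat.find (hP x))) x, Measurable.find hL hPm hP,
    fun x => ⟨leastParam_mem hp hε hε1 _ x, Nat.find_spec (hP x)⟩⟩

end Operators

/-! ### A Lyapunov function -/

section Lyapunov

variable {d : ℕ} {p ε : ℝ}

/-- The part of a ball that lies at least half a radius ahead of the centre in a given coordinate
direction contains a ball of a quarter of the radius. -/
theorem le_cond_ball_halfspace (i : Fin d) (x : Space d) {r : ℝ} (hr : 0 < r) :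
    (1 / 4 : ℝ) ^ d ≤ (ProbabilityTheory.cond (volume : Measure (Space d)) (ball x r)).real
      {y | x i + r / 2 ≤ y i} := by
  set w : Space d := x + EuclideanSpace.single i (3 * r / 4) with hw
  have hsub : ball w (r / 4) ⊆ ball x r ∩ {y | x i + r / 2 ≤ y i} := by
    intro y hy
    have hwx : dist w x = 3 * r / 4 := by
      rw [hw, dist_eq_norm, add_sub_cancel_left, PiLp.norm_single, Real.norm_eq_abs,
        abs_of_pos (by linarith)]
    have hyw : dist y w < r / 4 := hy
    refine ⟨mem_ball.2 ?_, ?_⟩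
    · linarith [dist_triangle y w x]
    · have h1 : |(y - w) i| ≤ ‖y - w‖ := PiLp.norm_apply_le (y - w) i
      rw [← dist_eq_norm] at h1
      have h2 : (y - w) i = y i - x i - 3 * r / 4 := by
        simp [hw, sub_sub]
      rw [h2] at h1
      change x i + r / 2 ≤ y i
      linarith [(abs_le.1 h1).1]
  have hB : (volume : Measure (Space d)) (ball x r) ≠ 0 := (measure_ball_pos _ _ hr).ne'
  have hBt : (volume : Measure (Space d)) (ball x r) ≠ ⊤ := measure_ball_lt_top.ne
  have hvol : (volume : Measure (Space d)).real (ball w (r / 4)) =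
      (1 / 4) ^ d * (volume : Measure (Space d)).real (ball x r) := by
    simp only [measureReal_def]
    rw [Measure.addHaar_ball_of_pos _ _ (by positivity : 0 < r / 4), Measure.addHaar_ball_of_pos _ _ hr,
      ENNReal.toReal_mul, ENNReal.toReal_mul, ENNReal.toReal_ofReal (by positivity),
      ENNReal.toReal_ofReal (by positivity), finrank_euclideanSpace_fin, ← mul_assoc, ← mul_pow]
    congr 2
    ring
  rw [measureReal_def, cond_apply measurableSet_ball, ENNReal.toReal_mul, ENNReal.toReal_inv]
  have hpos : 0 < (volume : Measure (Space d)).real (ball x r) := ENNReal.toReal_pos hB hBt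
  have hmono : (volume : Measure (Space d)).real (ball w (r / 4)) ≤
      (volume : Measure (Space d)).real (ball x r ∩ {y | x i + r / 2 ≤ y i}) :=
    measureReal_mono hsub (measure_ne_top_of_subset Set.inter_subset_left hBt)
  rw [hvol] at hmono
  simp only [measureReal_def] at hmono hpos
  rw [inv_mul_eq_div, le_div_iff₀ hpos]
  exact hmono

theorem le_setAverage_ball {ψ : Space d → ℝ} {C v r : ℝ} (hψ : Measurable ψ)
    (hC : ∀ x, |ψ x| ≤ C) (h0 : ∀ x, 0 ≤ ψ x) (hv : 0 ≤ v) (i : Fin d) (x : Space d) (hr : 0 < r)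
    (h : ∀ y : Space d, x i + r / 2 ≤ y i → v ≤ ψ y) :
    (1 / 4 : ℝ) ^ d * v ≤ ⨍ y in ball x r, ψ y := by
  have := isProbabilityMeasure_cond_ball x hr
  have hm : MeasurableSet {y : Space d | x i + r / 2 ≤ y i} :=
    measurableSet_le measurable_const (by fun_prop)
  rw [setAverage_eq_integral_cond]
  calc (1 / 4 : ℝ) ^ d * v
      ≤ (ProbabilityTheory.cond (volume : Measure (Space d)) (ball x r)).real
          {y | x i + r / 2 ≤ y i} * v := mul_le_mul_of_nonneg_right (le_cond_ball_halfspace i x hr) hv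
    _ = ∫ y, {y : Space d | x i + r / 2 ≤ y i}.indicator (fun _ => v) y
          ∂(ProbabilityTheory.cond (volume : Measure (Space d)) (ball x r)) := by
        rw [integral_indicator_const _ hm, smul_eq_mul]
    _ ≤ _ := by
        refine integral_mono ((integrable_const v).indicator hm) (integrable_of_abs_le hψ hC) ?_
        intro y
        by_cases hy : y ∈ {y : Space d | x i + r / 2 ≤ y i}
        · simpa only [Set.indicator_of_mem hy] using h y hy
        · simpa only [Set.indicator_of_notMem hy] using h0 y

/-- A bounded function whose mean decreases by at least `1` in every round of the game, whatever
the moves of the players. Even if both players always push the position backwards, the noise moves it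
ahead by a fixed length `a` with a fixed probability `δ`; so the mean of `L ^ (x_i / a)`, truncated
beyond `Ω`, is at least doubled in a round for `L = 2 / δ`. -/
theorem exists_lyapunov (hd : 1 ≤ d) (hp : 2 < p) (hε : 0 < ε) (hε1 : ε ≤ 1) {Ω : Set (Space d)}
    (hΩb : Bornology.IsBounded Ω) :
    ∃ (Φ : Space d → ℝ) (K : ℝ), Measurable Φ ∧ (∀ x, 1 ≤ Φ x ∧ Φ x ≤ K) ∧
      ∀ x ∈ Ω, ∀ c ∈ Set.Icc (cMin p ε) (cMax p ε), ∀ y z₁ z₂,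
        ∫ w, Φ w ∂(roundLaw p ε c x y z₁ z₂) ≤ Φ x - 1 := by
  let i : Fin d := ⟨0, hd⟩
  obtain ⟨D, hD⟩ := hΩb.exists_norm_le
  have hDi : ∀ x ∈ Ω, |x i| ≤ D := fun x hx => (PiLp.norm_apply_le x i).trans (hD x hx)
  have ha1 : 0 < 1 - alpha p := sub_pos.2 (alpha_lt_one hp)
  have hb := beta_pos (d := d) hp
  have hb1 : 0 < 1 - beta p d := sub_pos.2 (beta_lt_one (d := d) hp)
  set δ : ℝ := (1 - alpha p) * ((1 - beta p d) * (1 / 4) ^ d) with hδ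
  have hδ0 : 0 < δ := by positivity
  have hδ1 : δ ≤ 1 := by
    have h1 : (1 / 4 : ℝ) ^ d ≤ 1 := pow_le_one₀ (by norm_num) (by norm_num)
    have h2 : (1 - beta p d) * (1 / 4 : ℝ) ^ d ≤ 1 :=
      mul_le_one₀ (by linarith) (by positivity) h1
    exact mul_le_one₀ (by linarith [alpha_pos hp]) (by positivity) h2
  set L : ℝ := 2 / δ with hL
  have hL1 : 1 ≤ L := by rw [hL, le_div_iff₀ hδ0]; linarith
  have hL0 : 0 < L := by linarith
  set a : ℝ := tugRadius p d ε (cMax p ε) / 2 with ha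
  have ha0 : 0 < a := half_pos (tugRadius_pos hp hε (cMin_le_cMax hp hε hε1))
  -- The cap is reached only at distance `a` beyond `Ω`, so it does not cut a gain of `a` made from
  -- a position in `Ω`.
  set Kψ : ℝ := L ^ (D / a + 1) with hKψ
  set ψ : Space d → ℝ := fun x => min (L ^ (x i / a)) Kψ with hψdef
  have hKψ0 : 0 < Kψ := Real.rpow_pos_of_pos hL0 _
  have hψ0 : ∀ x, 0 ≤ ψ x := fun x => le_min (Real.rpow_nonneg hL0.le _) hKψ0.le
  have hψK : ∀ x, ψ x ≤ Kψ := fun x => min_le_right _ _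
  have hψa : ∀ x, |ψ x| ≤ Kψ := fun x => by rw [abs_of_nonneg (hψ0 x)]; exact hψK x
  have hψm : Measurable ψ := by
    have h : Measurable fun x : Space d => x i / a := by fun_prop
    exact ((measurable_const (a := L)).pow h).min measurable_const
  have hgrow : ∀ x ∈ Ω, ∀ c ∈ Set.Icc (cMin p ε) (cMax p ε), ∀ y z₁ z₂,
      ψ x + L ^ (-(D / a)) ≤ ∫ w, ψ w ∂(roundLaw p ε c x y z₁ z₂) := by
    intro x hx c hc y z₁ z₂
    have hc0 : 0 < c := (cMin_pos hε).trans_le hc.1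
    have hr := tugRadius_pos (d := d) hp hε hc.1
    have hxD := abs_le.1 (hDi x hx)
    have hv : ∀ y : Space d, x i + tugRadius p d ε c / 2 ≤ y i → L * L ^ (x i / a) ≤ ψ y := by
      intro y hy
      have har : a ≤ tugRadius p d ε c / 2 := by
        have := tugRadius_anti (d := d) hp hε hc0 hc.2
        linarith
      rw [mul_comm, ← Real.rpow_add_one hL0.ne']
      refine le_min (Real.rpow_le_rpow_of_exponent_le hL1 ?_)
        (Real.rpow_le_rpow_of_exponent_le hL1 ?_)
      · rw [div_add_one ha0.ne']
        exact div_le_div_of_nonneg_right (by linarith) ha0.le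
      · linarith [div_le_div_of_nonneg_right hxD.2 ha0.le]
    have hpow := Real.rpow_pos_of_pos hL0 (x i / a)
    have hav := le_setAverage_ball hψm hψa hψ0 (by positivity) i x hr hv
    rw [integral_roundLaw hp hε hc.1 hψm hψa]
    have e1 : δ * (L * L ^ (x i / a)) ≤
        (1 - alpha p) * ((1 - beta p d) * ⨍ y in ball x (tugRadius p d ε c), ψ y) := by
      rw [hδ, mul_assoc, mul_assoc]
      exact mul_le_mul_of_nonneg_left (mul_le_mul_of_nonneg_left hav hb1.le) ha1.le
    have e2 : δ * (L * L ^ (x i / a)) = L ^ (x i / a) + L ^ (x i / a) := by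
      rw [hL]; field_simp; ring
    have e3 : L ^ (-(D / a)) ≤ L ^ (x i / a) := by
      refine Real.rpow_le_rpow_of_exponent_le hL1 ?_
      rw [← neg_div]
      exact div_le_div_of_nonneg_right hxD.1 ha0.le
    have e4 : ψ x ≤ L ^ (x i / a) := min_le_left _ _
    have e5 : 0 ≤ alpha p * ψ y := mul_nonneg (alpha_pos hp).le (hψ0 y)
    have e6 : 0 ≤ (1 - alpha p) * (beta p d * ((1 / 2) * ψ z₁ + (1 / 2) * ψ z₂)) := by
      have := hψ0 z₁; have := hψ0 z₂
      positivity
    rw [mul_add]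
    linarith
  set Q : ℝ := L ^ (D / a) with hQ
  have hQ0 : 0 < Q := Real.rpow_pos_of_pos hL0 _
  have hQinv : Q * L ^ (-(D / a)) = 1 := by
    rw [hQ, ← Real.rpow_add hL0, add_neg_cancel, Real.rpow_zero]
  refine ⟨fun x => 1 + Q * (Kψ - ψ x), 1 + Q * Kψ,
    ((measurable_const.sub hψm).const_mul _).const_add _, fun x => ⟨?_, ?_⟩, ?_⟩
  · have := mul_nonneg hQ0.le (sub_nonneg.2 (hψK x))
    linarith
  · have := mul_nonneg hQ0.le (hψ0 x)
    linarith
  · intro x hx c hc y z₁ z₂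
    have := isProbabilityMeasure_roundLaw hp hε hc.1 x y z₁ z₂
    have hi : Integrable ψ (roundLaw p ε c x y z₁ z₂) := integrable_of_abs_le hψm hψa
    have h := mul_le_mul_of_nonneg_left (hgrow x hx c hc y z₁ z₂) hQ0.le
    rw [mul_add, hQinv] at h
    change ∫ w, (1 + Q * (Kψ - ψ w)) ∂(roundLaw p ε c x y z₁ z₂) ≤ 1 + Q * (Kψ - ψ x) - 1
    have hi' : Integrable (fun w => Kψ - ψ w) (roundLaw p ε c x y z₁ z₂) :=
      (integrable_const _).sub hi
    rw [integral_add (integrable_const _) (hi'.const_mul _),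
      integral_const_mul, integral_sub (integrable_const _) hi]
    simp only [integral_const, probReal_univ, smul_eq_mul, one_mul]
    linarith

end Lyapunov

/-! ### Solving the dynamic programming principle -/

/-- A map of the class `B` of bounded measurable functions that is a contraction for the sup norm
weighted by `1 / Φ` has exactly one fixed point. -/
theorem exists_unique_fixedPoint {X : Type*} [MeasurableSpace X] {T : (X → ℝ) → X → ℝ}
    {B : (X → ℝ) → Prop} (hB : ∀ φ, B φ ↔ Measurable φ ∧ ∃ C : ℝ, ∀ x, |φ x| ≤ C)
    (hT : ∀ φ, B φ → B (T φ)) {Φ : X → ℝ} {K θ : ℝ} (hΦ : ∀ x, 1 ≤ Φ x ∧ Φ x ≤ K)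
    (hθ0 : 0 ≤ θ) (hθ1 : θ < 1)
    (hc : ∀ φ ψ, B φ → B ψ → ∀ κ : ℝ, 0 ≤ κ → (∀ x, |φ x - ψ x| ≤ κ * Φ x) →
      ∀ x, |T φ x - T ψ x| ≤ κ * θ * Φ x) :
    ∃ u, B u ∧ T u = u ∧ ∀ v, B v → T v = v → v = u := by
  have hweight : ∀ {φ : X → ℝ} {C : ℝ}, (∀ x, |φ x| ≤ C) → ∀ x, |φ x| ≤ |C| * Φ x := fun hC x =>
    ((hC x).trans (le_abs_self _)).trans (le_mul_of_one_le_right (abs_nonneg _) (hΦ x).1)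
  have hiter : ∀ φ ψ, B φ → B ψ → ∃ κ : ℝ, 0 ≤ κ ∧
      ∀ n x, |T^[n] φ x - T^[n] ψ x| ≤ κ * θ ^ n * Φ x := by
    intro φ ψ hφ hψ
    obtain ⟨C₁, h₁⟩ := ((hB φ).1 hφ).2
    obtain ⟨C₂, h₂⟩ := ((hB ψ).1 hψ).2
    refine ⟨|C₁ + C₂|, abs_nonneg _, fun n => ?_⟩
    have hBn : ∀ φ, B φ → ∀ n, B (T^[n] φ) := by
      intro φ hφ n
      induction n with
      | zero => exact hφ
      | succ n ih => rw [Function.iterate_succ_apply']; exact hT _ ih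
    induction n with
    | zero =>
      intro x
      rw [pow_zero, mul_one]
      exact hweight (φ := fun x => φ x - ψ x)
        (fun x => (abs_sub _ _).trans (add_le_add (h₁ x) (h₂ x))) x
    | succ n ih =>
      intro x
      rw [Function.iterate_succ_apply', Function.iterate_succ_apply', pow_succ, ← mul_assoc]
      exact hc _ _ (hBn φ hφ n) (hBn ψ hψ n) _ (by positivity) ih x
  have hzero : B fun _ => 0 := (hB _).2 ⟨measurable_const, 0, by simp⟩
  set w : ℕ → X → ℝ := fun n => T^[n] fun _ => 0 with hw
  have hwB : ∀ n, B (w n) := by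
    intro n
    induction n with
    | zero => exact hzero
    | succ n ih => simp only [hw, Function.iterate_succ_apply'] at ih ⊢; exact hT _ ih
  obtain ⟨κ, hκ, hstep⟩ := hiter _ _ hzero (hT _ hzero)
  have hgeo : ∀ x n, dist (w n x) (w (n + 1) x) ≤ κ * K * θ ^ n := by
    intro x n
    have h := hstep n x
    rw [← Function.iterate_succ_apply] at h
    rw [Real.dist_eq]
    refine h.trans ?_
    rw [mul_right_comm]
    exact mul_le_mul_of_nonneg_right (mul_le_mul_of_nonneg_left (hΦ x).2 hκ) (pow_nonneg hθ0 n)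
  have hlim : ∀ x, ∃ l, Tendsto (fun n => w n x) atTop (𝓝 l) := fun x =>
    cauchySeq_tendsto_of_complete (cauchySeq_of_le_geometric θ _ hθ1 (hgeo x))
  choose u hu using hlim
  have hdist : ∀ n x, |w n x - u x| ≤ κ * K * θ ^ n / (1 - θ) := fun n x => by
    rw [← Real.dist_eq]
    exact dist_le_of_le_geometric_of_tendsto θ _ hθ1 (hgeo x) (hu x) n
  have huB : B u := by
    refine (hB u).2 ⟨measurable_of_tendsto_metrizable (fun n => ((hB _).1 (hwB n)).1)
      (tendsto_pi_nhds.2 hu), κ * K * θ ^ 0 / (1 - θ), fun x => ?_⟩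
    have h := hdist 0 x
    rwa [show w 0 x = 0 from rfl, zero_sub, abs_neg] at h
  have hfix : T u = u := by
    funext x
    have hK : 0 ≤ K := zero_le_one.trans ((hΦ x).1.trans (hΦ x).2)
    have h1 : Tendsto (fun n => w (n + 1) x) atTop (𝓝 (T u x)) := by
      rw [tendsto_iff_dist_tendsto_zero]
      refine squeeze_zero (fun _ => dist_nonneg) (g := fun n => κ * K * θ ^ n / (1 - θ) * θ * Φ x)
        (fun n => ?_) ?_
      · rw [Real.dist_eq]
        simp only [hw, Function.iterate_succ_apply']
        have h0 : 0 ≤ κ * K * θ ^ n / (1 - θ) := div_nonneg (by positivity) (by linarith)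
        exact hc _ _ (hwB n) huB _ h0
          (fun y => (hdist n y).trans (le_mul_of_one_le_right h0 (hΦ y).1)) x
      · have := ((((tendsto_pow_atTop_nhds_zero_of_lt_one hθ0 hθ1).const_mul (κ * K)).div_const
          (1 - θ)).mul_const θ).mul_const (Φ x)
        simpa using this
    exact tendsto_nhds_unique h1 ((tendsto_add_atTop_iff_nat 1).2 (hu x))
  refine ⟨u, huB, hfix, fun v hv hvfix => funext fun x => ?_⟩
  obtain ⟨κ', -, h⟩ := hiter v u hv huB
  have h0 : Tendsto (fun n => κ' * θ ^ n * Φ x) atTop (𝓝 0) := by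
    simpa using ((tendsto_pow_atTop_nhds_zero_of_lt_one hθ0 hθ1).const_mul κ').mul_const (Φ x)
  have h1 : |v x - u x| ≤ 0 := ge_of_tendsto' h0 fun n => by
    have := h n x
    rwa [Function.iterate_fixed hvfix, Function.iterate_fixed hfix] at this
  exact sub_eq_zero.1 (abs_nonpos_iff.1 h1)

section Data

variable {d : ℕ} {p : ℝ} {Ω : Set (Space d)} {f g : Space d → ℝ}

theorem measurable_J (p : ℝ) : Measurable (J p) := by
  unfold J
  exact Measurable.ite measurableSet_Ici (by fun_prop) (by fun_prop)

theorem abs_J_le (hp : 2 < p) {ξ F : ℝ} (h : |ξ| ≤ F) : |J p ξ| ≤ F ^ (1 / (p - 1)) := by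
  have hp1 : 0 ≤ 1 / (p - 1) := by
    have : 0 < p - 1 := by linarith
    positivity
  have e : |J p ξ| = |ξ| ^ (1 / (p - 1)) := by
    unfold J
    split_ifs with h0
    · rw [abs_of_nonneg (Real.rpow_nonneg h0 _), abs_of_nonneg h0]
    · have h1 : ξ < 0 := not_le.1 h0
      rw [abs_neg, abs_of_nonneg (Real.rpow_nonneg (by linarith) _), abs_of_neg h1]
  rw [e]
  exact Real.rpow_le_rpow (abs_nonneg _) h hp1

theorem measurable_indicator_of_continuousOn {s : Set (Space d)} (hs : MeasurableSet s)
    (hf : ContinuousOn f s) : Measurable (s.indicator f) := by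
  classical
  rw [← Set.piecewise_eq_indicator]
  exact hf.measurable_piecewise continuousOn_const hs

/-- `J_p ∘ f` in `Ω`, extended by zero. -/
noncomputable def runningCost (p : ℝ) {d : ℕ} (Ω : Set (Space d)) (f : Space d → ℝ) :
    Space d → ℝ :=
  Ω.indicator fun x => J p (f x)

theorem measurable_runningCost (hΩ : IsOpen Ω) (hf : ContinuousOn f (closure Ω)) :
    Measurable (runningCost p Ω f) := by
  have h : runningCost p Ω f = Ω.indicator fun x => J p (Ω.indicator f x) := by
    unfold runningCost
    refine Set.indicator_congr fun x hx => ?_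
    rw [Set.indicator_of_mem hx]
  rw [h]
  exact ((measurable_J p).comp (measurable_indicator_of_continuousOn hΩ.measurableSet
    (hf.mono subset_closure))).indicator hΩ.measurableSet

theorem exists_abs_runningCost_le (hp : 2 < p) (hΩb : Bornology.IsBounded Ω)
    (hf : ContinuousOn f (closure Ω)) : ∃ C : ℝ, 0 ≤ C ∧ ∀ x, |runningCost p Ω f x| ≤ C := by
  obtain ⟨F, hF⟩ := hΩb.isCompact_closure.exists_bound_of_continuousOn hf
  have h0 : 0 ≤ |F| ^ (1 / (p - 1)) := Real.rpow_nonneg (abs_nonneg _) _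
  refine ⟨_, h0, fun x => ?_⟩
  by_cases hx : x ∈ Ω
  · rw [runningCost, Set.indicator_of_mem hx]
    exact abs_J_le hp ((hF x (subset_closure hx)).trans (le_abs_self F))
  · rw [runningCost, Set.indicator_of_notMem hx, abs_zero]
    exact h0

theorem measurableSet_nonneg (hΩ : IsOpen Ω) (hf : ContinuousOn f (closure Ω)) :
    MeasurableSet (Ω ∩ {x | 0 ≤ f x}) := by
  have h : Ω ∩ {x | 0 ≤ f x} = Ω ∩ {x | 0 ≤ Ω.indicator f x} := by
    ext x
    by_cases hx : x ∈ Ω <;> simp [hx]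
  rw [h]
  exact hΩ.measurableSet.inter (measurableSet_le measurable_const
    (measurable_indicator_of_continuousOn hΩ.measurableSet (hf.mono subset_closure)))

end Data

section DPP

variable {d : ℕ} {p ε : ℝ} {Ω : Set (Space d)} {f g : Space d → ℝ}

open Classical in
/-- The map whose fixed points are the solutions of the dynamic programming principle. -/
noncomputable def dppMap (p : ℝ) {d : ℕ} (ε : ℝ) (Ω : Set (Space d)) (f g φ : Space d → ℝ)
    (x : Space d) : ℝ :=
  if x ∈ Ω then A p ε φ f x - ε ^ 2 * J p (f x) else g x

theorem measurable_dppMap (hp : 2 < p) (hε : 0 < ε) (hε1 : ε ≤ 1) (hΩ : IsOpen Ω)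
    (hf : ContinuousOn f (closure Ω)) (hg : ContinuousOn g Ωᶜ) {φ : Space d → ℝ} {C : ℝ}
    (hφ : Measurable φ) (hC : ∀ x, |φ x| ≤ C) : Measurable (dppMap p ε Ω f g φ) := by
  classical
  have e : dppMap p ε Ω f g φ = fun x =>
      if x ∈ Ω ∩ {x | 0 ≤ f x} then Aplus p ε φ x - ε ^ 2 * runningCost p Ω f x
      else if x ∈ Ω then Aminus p ε φ x - ε ^ 2 * runningCost p Ω f x
      else Ωᶜ.indicator g x := by
    funext x
    by_cases hx : x ∈ Ω <;> by_cases h0 : 0 ≤ f x <;> simp [dppMap, A, runningCost, hx, h0]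
  have hr := (measurable_runningCost (p := p) hΩ hf).const_mul (ε ^ 2)
  rw [e]
  exact Measurable.ite (measurableSet_nonneg hΩ hf) ((measurable_Aplus hp hε hε1 hφ hC).sub hr)
    (Measurable.ite hΩ.measurableSet ((measurable_Aminus hp hε hε1 hφ hC).sub hr)
      (measurable_indicator_of_continuousOn hΩ.measurableSet.compl hg))

theorem abs_A_le (hp : 2 < p) (hε : 0 < ε) (hε1 : ε ≤ 1) {φ : Space d → ℝ} {C : ℝ}
    (hφ : Measurable φ) (hC : ∀ x, |φ x| ≤ C) (x : Space d) : |A p ε φ f x| ≤ C := by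
  unfold A
  split_ifs
  · exact abs_Aplus_le hp hε hε1 hφ hC x
  · rw [Aminus_eq, abs_neg]
    exact abs_Aplus_le hp hε hε1 hφ.neg (by simpa using hC) x

theorem exists_abs_dppMap_le (hp : 2 < p) (hε : 0 < ε) (hε1 : ε ≤ 1)
    (hΩb : Bornology.IsBounded Ω) (hf : ContinuousOn f (closure Ω))
    (hgb : ∃ C : ℝ, ∀ x ∈ Ωᶜ, |g x| ≤ C) {φ : Space d → ℝ} {C : ℝ}
    (hφ : Measurable φ) (hC : ∀ x, |φ x| ≤ C) : ∃ C' : ℝ, ∀ x, |dppMap p ε Ω f g φ x| ≤ C' := by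
  obtain ⟨Cr, hr0, hr⟩ := exists_abs_runningCost_le hp hΩb hf
  obtain ⟨Cg, hg⟩ := hgb
  have hC0 : 0 ≤ C := (abs_nonneg _).trans (hC 0)
  refine ⟨C + ε ^ 2 * Cr + |Cg|, fun x => ?_⟩
  unfold dppMap
  split_ifs with hx
  · have h1 := abs_A_le (f := f) hp hε hε1 hφ hC x
    have h2 : |ε ^ 2 * J p (f x)| ≤ ε ^ 2 * Cr := by
      rw [abs_mul, abs_of_nonneg (sq_nonneg ε)]
      refine mul_le_mul_of_nonneg_left ?_ (sq_nonneg ε)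
      simpa [runningCost, hx] using hr x
    linarith [abs_sub (A p ε φ f x) (ε ^ 2 * J p (f x)), abs_nonneg Cg]
  · have h1 := (hg x hx).trans (le_abs_self Cg)
    have h2 : 0 ≤ ε ^ 2 * Cr := by positivity
    linarith

theorem dppMap_le_add (hp : 2 < p) (hε : 0 < ε) (hε1 : ε ≤ 1) {Φ φ ψ : Space d → ℝ}
    {K Cφ Cψ κ : ℝ} (hΦm : Measurable Φ) (hΦ : ∀ x, 1 ≤ Φ x ∧ Φ x ≤ K)
    (hL : ∀ x ∈ Ω, ∀ c ∈ Set.Icc (cMin p ε) (cMax p ε), ∀ y z₁ z₂,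
        ∫ w, Φ w ∂(roundLaw p ε c x y z₁ z₂) ≤ Φ x - 1)
    (hφ : Measurable φ) (hCφ : ∀ x, |φ x| ≤ Cφ) (hψ : Measurable ψ) (hCψ : ∀ x, |ψ x| ≤ Cψ)
    (hκ : 0 ≤ κ) (hle : ∀ x, φ x ≤ ψ x + κ * Φ x) (x : Space d) :
    dppMap p ε Ω f g φ x ≤ dppMap p ε Ω f g ψ x + κ * (Φ x - 1) := by
  unfold dppMap
  split_ifs with hx
  · have hk : ∀ c ∈ Set.Icc (cMin p ε) (cMax p ε), ∀ y z₁ z₂,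
        ∫ w, κ * Φ w ∂(roundLaw p ε c x y z₁ z₂) ≤ κ * (Φ x - 1) := by
      intro c hc y z₁ z₂
      rw [integral_const_mul]
      exact mul_le_mul_of_nonneg_left (hL x hx c hc y z₁ z₂) hκ
    have hCχ : ∀ x, |κ * Φ x| ≤ κ * K := fun x => by
      rw [abs_of_nonneg (mul_nonneg hκ (zero_le_one.trans (hΦ x).1))]
      exact mul_le_mul_of_nonneg_left (hΦ x).2 hκ
    have h : A p ε φ f x ≤ A p ε ψ f x + κ * (Φ x - 1) := by
      unfold A
      split_ifs
      · exact Aplus_le_add hp hε hε1 hφ hCφ hψ hCψ (hΦm.const_mul κ) hCχ hle hk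
      · exact Aminus_le_add hp hε hε1 hφ hCφ hψ hCψ (hΦm.const_mul κ) hCχ hle hk
    linarith
  · have := mul_nonneg hκ (sub_nonneg.2 (hΦ x).1)
    linarith

theorem isDPPSolution_iff {u : Space d → ℝ} : IsDPPSolution p ε Ω f g u ↔
    (Measurable u ∧ ∃ C : ℝ, ∀ x, |u x| ≤ C) ∧ dppMap p ε Ω f g u = u := by
  constructor
  · intro h
    refine ⟨⟨h.measurable, h.bounded⟩, funext fun x => ?_⟩
    by_cases hx : x ∈ Ω
    · rw [dppMap, if_pos hx, h.eq_inside x hx]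
    · rw [dppMap, if_neg hx, h.eq_outside x hx]
  · rintro ⟨⟨hm, hb⟩, h⟩
    refine ⟨hm, hb, fun x hx => ?_, fun x hx => ?_⟩
    · rw [← congrFun h x, dppMap, if_pos hx]
    · rw [← congrFun h x, dppMap, if_neg hx]

/-- The Lyapunov function `Φ` makes the map of the dynamic programming principle a contraction for
the norm weighted by `1 / Φ`, with factor `1 - 1 / sup Φ`. -/
theorem exists_unique_isDPPSolution (hd : 1 ≤ d) (hp : 2 < p) (hε : 0 < ε) (hε1 : ε ≤ 1)
    (hΩ : IsOpen Ω) (hΩb : Bornology.IsBounded Ω) (hf : ContinuousOn f (closure Ω))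
    (hg : ContinuousOn g Ωᶜ) (hgb : ∃ C : ℝ, ∀ x ∈ Ωᶜ, |g x| ≤ C) :
    ∃ u, IsDPPSolution p ε Ω f g u ∧ ∀ v, IsDPPSolution p ε Ω f g v → v = u := by
  obtain ⟨Φ, K, hΦm, hΦ, hL⟩ := exists_lyapunov (Ω := Ω) hd hp hε hε1 hΩb
  have hK1 : 1 ≤ K := (hΦ 0).1.trans (hΦ 0).2
  have hK0 : 0 < K := by linarith
  have hθ : ∀ x, Φ x - 1 ≤ (1 - 1 / K) * Φ x := fun x => by
    have h : Φ x / K ≤ 1 := (div_le_one hK0).2 (hΦ x).2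
    have e : (1 - 1 / K) * Φ x = Φ x - Φ x / K := by ring
    linarith
  obtain ⟨u, hu, hfix, huniq⟩ := exists_unique_fixedPoint (T := dppMap p ε Ω f g)
    (B := fun φ => Measurable φ ∧ ∃ C : ℝ, ∀ x, |φ x| ≤ C) (fun _ => Iff.rfl)
    (fun φ ⟨hφ, C, hC⟩ => ⟨measurable_dppMap hp hε hε1 hΩ hf hg hφ hC,
      exists_abs_dppMap_le hp hε hε1 hΩb hf hgb hφ hC⟩) hΦ (θ := 1 - 1 / K)
    (sub_nonneg.2 ((div_le_one hK0).2 hK1)) (sub_lt_self _ (by positivity)) (by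
      rintro φ ψ ⟨hφ, Cφ, hCφ⟩ ⟨hψ, Cψ, hCψ⟩ κ hκ h x
      have h1 := dppMap_le_add (f := f) (g := g) hp hε hε1 hΦm hΦ hL hφ hCφ hψ hCψ hκ
        (fun y => by linarith [(abs_le.1 (h y)).2]) x
      have h2 := dppMap_le_add (f := f) (g := g) hp hε hε1 hΦm hΦ hL hψ hCψ hφ hCφ hκ
        (fun y => by linarith [(abs_le.1 (h y)).1]) x
      have h3 := mul_le_mul_of_nonneg_left (hθ x) hκ
      rw [abs_le]
      constructor <;> linarith)
  exact ⟨u, isDPPSolution_iff.2 ⟨hu, hfix⟩, fun v hv =>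
    huniq v (isDPPSolution_iff.1 hv).1 (isDPPSolution_iff.1 hv).2⟩

end DPP

/-! ### The process of positions -/

open Preorder

section Positions

variable {d : ℕ} {p ε : ℝ} {Ω : Set (Space d)} {f g : Space d → ℝ} (hp : 2 < p) (hε : 0 < ε)
  (hΩ : IsOpen Ω) (hf : ContinuousOn f (closure Ω)) (S₁ S₂ : Strategy p d ε) (x₀ : Space d)

theorem isProbabilityMeasure_gameLaw :
    IsProbabilityMeasure (gameLaw hp hε hΩ hf S₁ S₂ x₀) := by
  have := fun n => isMarkovKernel_stepKernel hp hε hΩ hf S₁ S₂ n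
  unfold gameLaw
  infer_instance

/-- The Markov property: the next position has the transition law given the partial history. -/
theorem map_gameLaw_succ (n : ℕ) :
    (gameLaw hp hε hΩ hf S₁ S₂ x₀).map (fun ω => (frestrictLe (π := fun _ => Space d) n ω, ω (n + 1)))
      = ((gameLaw hp hε hΩ hf S₁ S₂ x₀).map (frestrictLe (π := fun _ => Space d) n)) ⊗ₘ
        stepKernel hΩ hf S₁ S₂ n := by
  have := fun n => isMarkovKernel_stepKernel hp hε hΩ hf S₁ S₂ n
  unfold gameLaw
  rw [Kernel.traj_map_frestrictLe_apply]
  exact (Kernel.partialTraj_compProd_eq_map_traj (X := fun _ => Space d)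
    (κ := fun n => stepKernel hΩ hf S₁ S₂ n) (Nat.zero_le n)).symm

theorem ae_gameLaw_zero : ∀ᵐ ω ∂(gameLaw hp hε hΩ hf S₁ S₂ x₀), ω 0 = x₀ := by
  have := fun n => isMarkovKernel_stepKernel hp hε hΩ hf S₁ S₂ n
  have h : (gameLaw hp hε hΩ hf S₁ S₂ x₀).map (frestrictLe (π := fun _ => Space d) 0)
      = Measure.dirac (fun _ => x₀) := by
    unfold gameLaw
    rw [Kernel.traj_map_frestrictLe_apply, Kernel.partialTraj_self, Kernel.id_apply]
  have hm : MeasurableSet {h : History d 0 | h.last = x₀} :=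
    measurable_last (measurableSet_singleton x₀)
  have hfr : Measurable (frestrictLe (π := fun _ : ℕ => Space d) 0) := measurable_frestrictLe 0
  refine (ae_map_iff hfr.aemeasurable hm).1 ?_
  rw [h, ae_dirac_iff hm]
  rfl

/-- The position no longer changes once it is outside `Ω`. -/
theorem ae_gameLaw_absorbed :
    ∀ᵐ ω ∂(gameLaw hp hε hΩ hf S₁ S₂ x₀), ∀ n, ω n ∉ Ω → ω (n + 1) = ω n := by
  have := fun n => isMarkovKernel_stepKernel hp hε hΩ hf S₁ S₂ n
  have := isProbabilityMeasure_gameLaw hp hε hΩ hf S₁ S₂ x₀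
  refine ae_all_iff.2 fun n => ?_
  have hm : MeasurableSet {z : History d n × Space d | z.1.last ∉ Ω → z.2 = z.1.last} := by
    have e : {z : History d n × Space d | z.1.last ∉ Ω → z.2 = z.1.last} =
        (fun z : History d n × Space d => z.1.last) ⁻¹' Ω ∪
          {z : History d n × Space d | z.2 = z.1.last} := by
      ext z
      by_cases hz : z.1.last ∈ Ω <;> simp [hz]
    rw [e]
    exact ((measurable_last.comp measurable_fst) hΩ.measurableSet).union
      (measurableSet_eq_fun measurable_snd (measurable_last.comp measurable_fst))
  have hpair : Measurable fun ω : ℕ → Space d =>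
      (frestrictLe (π := fun _ => Space d) n ω, ω (n + 1)) :=
    (measurable_frestrictLe n).prodMk (measurable_pi_apply (n + 1))
  refine (ae_map_iff hpair.aemeasurable hm).1 ?_
  rw [map_gameLaw_succ, Measure.ae_compProd_iff hm]
  refine Eventually.of_forall fun h => ?_
  by_cases hh : h.last ∈ Ω
  · exact Eventually.of_forall fun _ hn => absurd hh hn
  · have e : stepKernel hΩ hf S₁ S₂ n h = Measure.dirac h.last := by
      change stepLaw p ε Ω f S₁ S₂ n h = _
      rw [stepLaw, if_neg hh]
    rw [e]
    exact (ae_dirac_iff (hm.preimage measurable_prodMk_left)).2 fun _ => rfl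

theorem integral_gameLaw_succ {v : Space d → ℝ} {C : ℝ} (hv : Measurable v)
    (hC : ∀ x, |v x| ≤ C) (n : ℕ) :
    Integrable (fun ω => ∫ y, v y ∂(stepLaw p ε Ω f S₁ S₂ n (frestrictLe n ω)))
      (gameLaw hp hε hΩ hf S₁ S₂ x₀) ∧
    ∫ ω, v (ω (n + 1)) ∂(gameLaw hp hε hΩ hf S₁ S₂ x₀) =
      ∫ ω, (∫ y, v y ∂(stepLaw p ε Ω f S₁ S₂ n (frestrictLe n ω)))
        ∂(gameLaw hp hε hΩ hf S₁ S₂ x₀) := by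
  have := fun n => isMarkovKernel_stepKernel hp hε hΩ hf S₁ S₂ n
  have := isProbabilityMeasure_gameLaw hp hε hΩ hf S₁ S₂ x₀
  have hfr : Measurable (frestrictLe (π := fun _ : ℕ => Space d) n) := measurable_frestrictLe n
  have : IsProbabilityMeasure ((gameLaw hp hε hΩ hf S₁ S₂ x₀).map
      (frestrictLe (π := fun _ => Space d) n)) := Measure.isProbabilityMeasure_map hfr.aemeasurable
  have hsm : StronglyMeasurable fun h : History d n => ∫ y, v y ∂(stepKernel hΩ hf S₁ S₂ n h) :=
    hv.stronglyMeasurable.integral_kernel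
  refine ⟨integrable_of_abs_le (C := C) (hsm.measurable.comp hfr) fun ω => ?_, ?_⟩
  · have := isProbabilityMeasure_stepLaw hp hε Ω f S₁ S₂ n (frestrictLe n ω)
    simpa using norm_integral_le_of_norm_le_const (f := v)
      (μ := stepLaw p ε Ω f S₁ S₂ n (frestrictLe n ω)) (Eventually.of_forall hC)
  · have hpair : Measurable fun ω : ℕ → Space d =>
        (frestrictLe (π := fun _ => Space d) n ω, ω (n + 1)) :=
      hfr.prodMk (measurable_pi_apply (n + 1))
    have h1 := integral_map (μ := gameLaw hp hε hΩ hf S₁ S₂ x₀) hpair.aemeasurable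
      (f := fun z : History d n × Space d => v z.2)
      (hv.comp measurable_snd).aestronglyMeasurable
    have h2 : Integrable (fun z : History d n × Space d => v z.2)
        (((gameLaw hp hε hΩ hf S₁ S₂ x₀).map (frestrictLe (π := fun _ => Space d) n)) ⊗ₘ
        stepKernel hΩ hf S₁ S₂ n) :=
      integrable_of_abs_le (hv.comp measurable_snd) fun z => hC z.2
    rw [map_gameLaw_succ, Measure.integral_compProd h2,
      integral_map hfr.aemeasurable hsm.aestronglyMeasurable] at h1
    exact h1.symm

theorem integrable_comp_eval {v : Space d → ℝ} {C : ℝ} (hv : Measurable v) (hC : ∀ x, |v x| ≤ C)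
    (n : ℕ) : Integrable (fun ω => v (ω n)) (gameLaw hp hε hΩ hf S₁ S₂ x₀) := by
  have := isProbabilityMeasure_gameLaw hp hε hΩ hf S₁ S₂ x₀
  exact integrable_of_abs_le (hv.comp (measurable_pi_apply n)) fun ω => hC (ω n)

/-- If in every round `v` gains at least `ℓ` in the mean, then `v(x_n)` less the gains collected in
`Ω` up to time `n` has mean at least `v(x₀)`. -/
theorem le_integral_sub_sum {v ℓ : Space d → ℝ} {Cv Cℓ : ℝ} (hv : Measurable v)
    (hCv : ∀ x, |v x| ≤ Cv) (hℓ : Measurable ℓ) (hCℓ : ∀ x, |ℓ x| ≤ Cℓ)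
    (hℓΩ : ∀ x, x ∉ Ω → ℓ x = 0)
    (h : ∀ n (h : History d n), h.last ∈ Ω →
      v h.last + ℓ h.last ≤ ∫ y, v y ∂(stepLaw p ε Ω f S₁ S₂ n h)) (n : ℕ) :
    v x₀ ≤ ∫ ω, (v (ω n) - ∑ i ∈ Finset.range n, ℓ (ω i)) ∂(gameLaw hp hε hΩ hf S₁ S₂ x₀) := by
  have := isProbabilityMeasure_gameLaw hp hε hΩ hf S₁ S₂ x₀
  have iv := fun n => integrable_comp_eval hp hε hΩ hf S₁ S₂ x₀ hv hCv n
  have iℓ := fun n => integrable_comp_eval hp hε hΩ hf S₁ S₂ x₀ hℓ hCℓ n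
  have is := fun n => integrable_finsetSum (Finset.range n) fun i _ => iℓ i
  induction n with
  | zero =>
    have e : (fun ω : ℕ → Space d => v (ω 0)) =ᵐ[gameLaw hp hε hΩ hf S₁ S₂ x₀] fun _ => v x₀ := by
      filter_upwards [ae_gameLaw_zero hp hε hΩ hf S₁ S₂ x₀] with ω hω
      rw [hω]
    simp only [Finset.range_zero, Finset.sum_empty, sub_zero]
    rw [integral_congr_ae e]
    simp
  | succ n ih =>
    refine ih.trans ?_
    obtain ⟨hi, he⟩ := integral_gameLaw_succ hp hε hΩ hf S₁ S₂ x₀ hv hCv n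
    have hstep : ∫ ω, (v (ω n) + ℓ (ω n)) ∂(gameLaw hp hε hΩ hf S₁ S₂ x₀) ≤
        ∫ ω, v (ω (n + 1)) ∂(gameLaw hp hε hΩ hf S₁ S₂ x₀) := by
      rw [he]
      refine integral_mono ((iv n).add (iℓ n)) hi fun ω => ?_
      set k : History d n := frestrictLe (π := fun _ => Space d) n ω with hk
      have hlast : k.last = ω n := rfl
      by_cases hω : ω n ∈ Ω
      · exact h n k hω
      · have e : stepLaw p ε Ω f S₁ S₂ n k = Measure.dirac (ω n) := by
          rw [stepLaw, if_neg (hlast ▸ hω), hlast]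
        change v (ω n) + ℓ (ω n) ≤ ∫ y, v y ∂(stepLaw p ε Ω f S₁ S₂ n k)
        rw [e, integral_dirac, hℓΩ _ hω, add_zero]
    rw [integral_sub (iv n) (is n), integral_sub (iv (n + 1)) (is (n + 1))]
    simp only [Finset.sum_range_succ]
    rw [integral_add (is n) (iℓ n)]
    rw [integral_add (iv n) (iℓ n)] at hstep
    linarith

/-- The number of rounds played has a finite mean. -/
theorem lintegral_tsum_indicator_lt_top (hd : 1 ≤ d) (hε1 : ε ≤ 1)
    (hΩb : Bornology.IsBounded Ω) :
    ∫⁻ ω, ∑' n, Ω.indicator (fun _ => (1 : ENNReal)) (ω n) ∂(gameLaw hp hε hΩ hf S₁ S₂ x₀) < ⊤ := by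
  obtain ⟨Φ, K, hΦm, hΦ, hL⟩ := exists_lyapunov (Ω := Ω) hd hp hε hε1 hΩb
  have := isProbabilityMeasure_gameLaw hp hε hΩ hf S₁ S₂ x₀
  have h1m : Measurable (Ω.indicator fun _ => (1 : ℝ)) := measurable_const.indicator hΩ.measurableSet
  have h1b : ∀ x, |Ω.indicator (fun _ => (1 : ℝ)) x| ≤ 1 := fun x => by
    by_cases hx : x ∈ Ω <;> simp [hx]
  have hΦb : ∀ x, |Φ x| ≤ K := fun x => by
    rw [abs_of_nonneg (zero_le_one.trans (hΦ x).1)]; exact (hΦ x).2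
  have hpart : ∀ n, ∑ i ∈ Finset.range n,
      (gameLaw hp hε hΩ hf S₁ S₂ x₀) ((fun ω => ω i) ⁻¹' Ω) ≤ ENNReal.ofReal K := by
    intro n
    have h := le_integral_sub_sum hp hε hΩ hf S₁ S₂ x₀ hΦm.neg (by simpa using hΦb) h1m h1b
      (fun x hx => Set.indicator_of_notMem hx _) (fun n h hh => ?_) n
    · have iΦ := integrable_comp_eval hp hε hΩ hf S₁ S₂ x₀ hΦm hΦb n
      have i1 := fun n => integrable_comp_eval hp hε hΩ hf S₁ S₂ x₀ h1m h1b n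
      have hsum : ∫ ω, ∑ i ∈ Finset.range n, Ω.indicator (fun _ => (1 : ℝ)) (ω i)
          ∂(gameLaw hp hε hΩ hf S₁ S₂ x₀) = ∑ i ∈ Finset.range n,
            (gameLaw hp hε hΩ hf S₁ S₂ x₀).real ((fun ω => ω i) ⁻¹' Ω) := by
        rw [integral_finsetSum _ fun i _ => i1 i]
        refine Finset.sum_congr rfl fun i _ => ?_
        rw [← integral_indicator_one (hΩ.measurableSet.preimage (measurable_pi_apply i))]
        rfl
      have hneg : ∫ ω, (-Φ) (ω n) ∂(gameLaw hp hε hΩ hf S₁ S₂ x₀) =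
          -∫ ω, Φ (ω n) ∂(gameLaw hp hε hΩ hf S₁ S₂ x₀) := integral_neg _
      have iΦ' : Integrable (fun ω => (-Φ) (ω n)) (gameLaw hp hε hΩ hf S₁ S₂ x₀) := iΦ.neg
      rw [integral_sub iΦ' (integrable_finsetSum _ fun i _ => i1 i), hsum, hneg,
        Pi.neg_apply] at h
      have hpos : 0 ≤ ∫ ω, Φ (ω n) ∂(gameLaw hp hε hΩ hf S₁ S₂ x₀) :=
        integral_nonneg fun ω => zero_le_one.trans (hΦ _).1
      have hle : ∑ i ∈ Finset.range n,
          (gameLaw hp hε hΩ hf S₁ S₂ x₀).real ((fun ω => ω i) ⁻¹' Ω) ≤ K := by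
        linarith [(hΦ x₀).2]
      calc _ = ∑ i ∈ Finset.range n, ENNReal.ofReal
            ((gameLaw hp hε hΩ hf S₁ S₂ x₀).real ((fun ω => ω i) ⁻¹' Ω)) :=
            Finset.sum_congr rfl fun i _ => (ENNReal.ofReal_toReal (measure_ne_top _ _)).symm
        _ = ENNReal.ofReal _ := (ENNReal.ofReal_sum_of_nonneg fun i _ => measureReal_nonneg).symm
        _ ≤ _ := ENNReal.ofReal_le_ofReal hle
    · have hneg : ∀ μ : Measure (Space d), ∫ y, (-Φ) y ∂μ = -∫ y, Φ y ∂μ :=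
        fun μ => integral_neg _
      rw [hneg, Pi.neg_apply, Set.indicator_of_mem hh, stepLaw, if_pos hh]
      split_ifs
      · linarith [hL _ hh _ (S₂.select_mem n h) (S₁.jump n (h, S₂.select n h))
          (S₁.tug n (h, S₂.select n h)) (S₂.tug n (h, S₂.select n h))]
      · linarith [hL _ hh _ (S₁.select_mem n h) (S₂.jump n (h, S₁.select n h))
          (S₁.tug n (h, S₁.select n h)) (S₂.tug n (h, S₁.select n h))]
  have hm : ∀ n, Measurable fun ω : ℕ → Space d => Ω.indicator (fun _ => (1 : ENNReal)) (ω n) :=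
    fun n => (measurable_const.indicator hΩ.measurableSet).comp (measurable_pi_apply n)
  rw [lintegral_tsum fun n => (hm n).aemeasurable]
  have e : ∀ n, ∫⁻ ω, Ω.indicator (fun _ => (1 : ENNReal)) (ω n) ∂(gameLaw hp hε hΩ hf S₁ S₂ x₀) =
      (gameLaw hp hε hΩ hf S₁ S₂ x₀) ((fun ω => ω n) ⁻¹' Ω) := fun n => by
    rw [← lintegral_indicator_one (hΩ.measurableSet.preimage (measurable_pi_apply n))]
    rfl
  simp only [e]
  exact (ENNReal.tsum_le_of_sum_range_le hpart).trans_lt ENNReal.ofReal_lt_top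

theorem ae_exists_notMem (hd : 1 ≤ d) (hε1 : ε ≤ 1) (hΩb : Bornology.IsBounded Ω) :
    ∀ᵐ ω ∂(gameLaw hp hε hΩ hf S₁ S₂ x₀), ∃ n, ω n ∉ Ω := by
  have hm : Measurable fun ω : ℕ → Space d => ∑' n, Ω.indicator (fun _ => (1 : ENNReal)) (ω n) :=
    Measurable.tsum fun n =>
      (measurable_const.indicator hΩ.measurableSet).comp (measurable_pi_apply n)
  filter_upwards [ae_lt_top hm
    (lintegral_tsum_indicator_lt_top hp hε hΩ hf S₁ S₂ x₀ hd hε1 hΩb).ne] with ω hω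
  by_contra! hcon
  simp [hcon] at hω

/-- After the exit time, position and accumulated cost are frozen. -/
theorem eq_payoff_of_exitTime_le {ω : ℕ → Space d} {v : Space d → ℝ} (hvg : ∀ x, x ∉ Ω → v x = g x)
    (habs : ∀ n, ω n ∉ Ω → ω (n + 1) = ω n) (hex : ∃ n, ω n ∉ Ω) {n : ℕ} (hn : exitTime Ω ω ≤ n) :
    v (ω n) - ∑ i ∈ Finset.range n, ε ^ 2 * runningCost p Ω f (ω i) = payoff p ε Ω f g ω := by
  have hτ : ω (exitTime Ω ω) ∉ Ω := Nat.sInf_mem hex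
  have hlt : ∀ i < exitTime Ω ω, ω i ∈ Ω := fun i hi =>
    not_not.1 fun h => Nat.notMem_of_lt_sInf hi h
  have hconst : ∀ n, exitTime Ω ω ≤ n → ω n = ω (exitTime Ω ω) := by
    intro n hn
    induction n, hn using Nat.le_induction with
    | base => rfl
    | succ n hn ih => rw [habs n (ih ▸ hτ), ih]
  have hsum : ∑ i ∈ Finset.range n, ε ^ 2 * runningCost p Ω f (ω i) =
      ∑ i ∈ Finset.range (exitTime Ω ω), ε ^ 2 * J p (f (ω i)) := by
    rw [← Finset.sum_subset (Finset.range_mono hn)]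
    · refine Finset.sum_congr rfl fun i hi => ?_
      rw [runningCost, Set.indicator_of_mem (hlt i (Finset.mem_range.1 hi))]
    · intro i _ hi
      have hi' : exitTime Ω ω ≤ i := by simpa using hi
      rw [runningCost, Set.indicator_of_notMem (hconst i hi' ▸ hτ), mul_zero]
  rw [payoff, hsum, hconst n hn, hvg _ hτ, Finset.mul_sum]
  ring

/-- The payoff is integrable, and its mean is the limit of the means of the payoffs of the game
stopped at time `n`, in which a position in `Ω` is paid by `v`. All these are dominated by a multiple
of the number of rounds. -/
theorem integrable_payoff_and_tendsto (hd : 1 ≤ d) (hε1 : ε ≤ 1) (hΩb : Bornology.IsBounded Ω)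
    {v : Space d → ℝ} {C : ℝ} (hv : Measurable v) (hC : ∀ x, |v x| ≤ C)
    (hvg : ∀ x, x ∉ Ω → v x = g x) :
    Integrable (payoff p ε Ω f g) (gameLaw hp hε hΩ hf S₁ S₂ x₀) ∧
    Tendsto (fun n => ∫ ω, (v (ω n) - ∑ i ∈ Finset.range n, ε ^ 2 * runningCost p Ω f (ω i))
        ∂(gameLaw hp hε hΩ hf S₁ S₂ x₀)) atTop
      (𝓝 (expectedPayoff hp hε hΩ hf g S₁ S₂ x₀)) := by
  have := isProbabilityMeasure_gameLaw hp hε hΩ hf S₁ S₂ x₀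
  obtain ⟨Cr, hCr0, hCr⟩ := exists_abs_runningCost_le hp hΩb hf
  set N : (ℕ → Space d) → ENNReal := fun ω => ∑' n, Ω.indicator (fun _ => (1 : ENNReal)) (ω n) with hN
  have hNm : Measurable N := Measurable.tsum fun n =>
    (measurable_const.indicator hΩ.measurableSet).comp (measurable_pi_apply n)
  have hNfin : ∫⁻ ω, N ω ∂(gameLaw hp hε hΩ hf S₁ S₂ x₀) < ⊤ :=
    lintegral_tsum_indicator_lt_top hp hε hΩ hf S₁ S₂ x₀ hd hε1 hΩb
  have hNi : Integrable (fun ω => (N ω).toReal) (gameLaw hp hε hΩ hf S₁ S₂ x₀) :=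
    integrable_toReal_of_lintegral_ne_top hNm.aemeasurable hNfin.ne
  have hmeas : ∀ n, Measurable fun ω : ℕ → Space d =>
      v (ω n) - ∑ i ∈ Finset.range n, ε ^ 2 * runningCost p Ω f (ω i) := fun n =>
    (hv.comp (measurable_pi_apply n)).sub (Finset.measurable_sum _ fun i _ =>
      ((measurable_runningCost hΩ hf).comp (measurable_pi_apply i)).const_mul _)
  have hbound : ∀ n, ∀ᵐ ω ∂(gameLaw hp hε hΩ hf S₁ S₂ x₀),
      ‖v (ω n) - ∑ i ∈ Finset.range n, ε ^ 2 * runningCost p Ω f (ω i)‖ ≤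
        C + ε ^ 2 * Cr * (N ω).toReal := by
    intro n
    filter_upwards [ae_lt_top hNm hNfin.ne] with ω hω
    have h1 : ∑ i ∈ Finset.range n, Ω.indicator (fun _ => (1 : ℝ)) (ω i) ≤ (N ω).toReal := by
      have h2 := ENNReal.toReal_mono hω.ne (ENNReal.sum_le_tsum (Finset.range n)
        (f := fun i => Ω.indicator (fun _ => (1 : ENNReal)) (ω i)))
      rw [ENNReal.toReal_sum fun i _ => by by_cases hi : ω i ∈ Ω <;> simp [hi]] at h2
      refine le_trans (le_of_eq (Finset.sum_congr rfl fun i _ => ?_)) h2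
      by_cases hi : ω i ∈ Ω <;> simp [hi]
    have h3 : |∑ i ∈ Finset.range n, ε ^ 2 * runningCost p Ω f (ω i)| ≤
        ε ^ 2 * Cr * ∑ i ∈ Finset.range n, Ω.indicator (fun _ => (1 : ℝ)) (ω i) := by
      rw [Finset.mul_sum]
      refine (Finset.abs_sum_le_sum_abs _ _).trans (Finset.sum_le_sum fun i _ => ?_)
      by_cases hi : ω i ∈ Ω
      · rw [Set.indicator_of_mem hi, mul_one, abs_mul, abs_of_nonneg (sq_nonneg ε)]
        exact mul_le_mul_of_nonneg_left (hCr _) (sq_nonneg ε)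
      · rw [Set.indicator_of_notMem hi, runningCost, Set.indicator_of_notMem hi]
        simp
    have h4 : 0 ≤ ε ^ 2 * Cr := by positivity
    rw [Real.norm_eq_abs]
    exact (abs_sub _ _).trans
      (add_le_add (hC _) (h3.trans (mul_le_mul_of_nonneg_left h1 h4)))
  have hlim : ∀ᵐ ω ∂(gameLaw hp hε hΩ hf S₁ S₂ x₀), Tendsto (fun n =>
      v (ω n) - ∑ i ∈ Finset.range n, ε ^ 2 * runningCost p Ω f (ω i)) atTop
        (𝓝 (payoff p ε Ω f g ω)) := by
    filter_upwards [ae_gameLaw_absorbed hp hε hΩ hf S₁ S₂ x₀,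
      ae_exists_notMem hp hε hΩ hf S₁ S₂ x₀ hd hε1 hΩb] with ω h1 h2
    refine tendsto_const_nhds.congr' ?_
    filter_upwards [eventually_ge_atTop (exitTime Ω ω)] with n hn
    exact (eq_payoff_of_exitTime_le hvg h1 h2 hn).symm
  have hdom : Integrable (fun ω => C + ε ^ 2 * Cr * (N ω).toReal)
      (gameLaw hp hε hΩ hf S₁ S₂ x₀) := (integrable_const C).add (hNi.const_mul _)
  refine ⟨hdom.mono' (aestronglyMeasurable_of_tendsto_ae atTop
    (fun n => (hmeas n).aestronglyMeasurable) hlim) ?_, ?_⟩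
  · filter_upwards [hlim, ae_all_iff.2 hbound] with ω h1 h2
    exact le_of_tendsto' h1.norm h2
  · exact tendsto_integral_of_dominated_convergence _
      (fun n => (hmeas n).aestronglyMeasurable) hdom hbound hlim

/-- A subsolution, for the given strategies, that lies below `u` bounds the expected payoff from
below. -/
theorem le_expectedPayoff (hd : 1 ≤ d) (hε1 : ε ≤ 1) (hΩb : Bornology.IsBounded Ω)
    {u v : Space d → ℝ} {Cu Cv : ℝ} (hu : Measurable u) (hCu : ∀ x, |u x| ≤ Cu)
    (hug : ∀ x, x ∉ Ω → u x = g x) (hv : Measurable v) (hCv : ∀ x, |v x| ≤ Cv)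
    (hvu : ∀ x, v x ≤ u x)
    (h : ∀ n (h : History d n), h.last ∈ Ω →
      v h.last + ε ^ 2 * J p (f h.last) ≤ ∫ y, v y ∂(stepLaw p ε Ω f S₁ S₂ n h)) :
    v x₀ ≤ expectedPayoff hp hε hΩ hf g S₁ S₂ x₀ := by
  have := isProbabilityMeasure_gameLaw hp hε hΩ hf S₁ S₂ x₀
  obtain ⟨Cr, hCr0, hCr⟩ := exists_abs_runningCost_le hp hΩb hf
  have hℓ : Measurable fun x => ε ^ 2 * runningCost p Ω f x :=
    (measurable_runningCost hΩ hf).const_mul _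
  have hCℓ : ∀ x, |ε ^ 2 * runningCost p Ω f x| ≤ ε ^ 2 * Cr := fun x => by
    rw [abs_mul, abs_of_nonneg (sq_nonneg ε)]
    exact mul_le_mul_of_nonneg_left (hCr _) (sq_nonneg ε)
  have is := fun n => integrable_finsetSum (Finset.range n) fun i _ =>
    integrable_comp_eval hp hε hΩ hf S₁ S₂ x₀ hℓ hCℓ i
  refine ge_of_tendsto' (integrable_payoff_and_tendsto hp hε hΩ hf S₁ S₂ x₀ hd hε1 hΩb
    hu hCu hug).2 fun n => ?_
  refine (le_integral_sub_sum hp hε hΩ hf S₁ S₂ x₀ hv hCv hℓ hCℓ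
    (fun x hx => by rw [runningCost, Set.indicator_of_notMem hx, mul_zero])
    (fun n k hk => by rw [runningCost, Set.indicator_of_mem hk]; exact h n k hk) n).trans ?_
  exact integral_mono ((integrable_comp_eval hp hε hΩ hf S₁ S₂ x₀ hv hCv n).sub (is n))
    ((integrable_comp_eval hp hε hΩ hf S₁ S₂ x₀ hu hCu n).sub (is n))
    fun ω => sub_le_sub_right (hvu _) _

/-- A supersolution, for the given strategies, that lies above `u` bounds the expected payoff from
above. -/
theorem expectedPayoff_le (hd : 1 ≤ d) (hε1 : ε ≤ 1) (hΩb : Bornology.IsBounded Ω)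
    {u v : Space d → ℝ} {Cu Cv : ℝ} (hu : Measurable u) (hCu : ∀ x, |u x| ≤ Cu)
    (hug : ∀ x, x ∉ Ω → u x = g x) (hv : Measurable v) (hCv : ∀ x, |v x| ≤ Cv)
    (huv : ∀ x, u x ≤ v x)
    (h : ∀ n (h : History d n), h.last ∈ Ω →
      ∫ y, v y ∂(stepLaw p ε Ω f S₁ S₂ n h) ≤ v h.last + ε ^ 2 * J p (f h.last)) :
    expectedPayoff hp hε hΩ hf g S₁ S₂ x₀ ≤ v x₀ := by
  have := isProbabilityMeasure_gameLaw hp hε hΩ hf S₁ S₂ x₀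
  obtain ⟨Cr, hCr0, hCr⟩ := exists_abs_runningCost_le hp hΩb hf
  have hℓ : Measurable fun x => ε ^ 2 * runningCost p Ω f x :=
    (measurable_runningCost hΩ hf).const_mul _
  have hCℓ : ∀ x, |ε ^ 2 * runningCost p Ω f x| ≤ ε ^ 2 * Cr := fun x => by
    rw [abs_mul, abs_of_nonneg (sq_nonneg ε)]
    exact mul_le_mul_of_nonneg_left (hCr _) (sq_nonneg ε)
  have is := fun n => integrable_finsetSum (Finset.range n) fun i _ =>
    integrable_comp_eval hp hε hΩ hf S₁ S₂ x₀ hℓ hCℓ i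
  refine le_of_tendsto' (integrable_payoff_and_tendsto hp hε hΩ hf S₁ S₂ x₀ hd hε1 hΩb
    hu hCu hug).2 fun n => ?_
  have hneg := le_integral_sub_sum hp hε hΩ hf S₁ S₂ x₀ (v := fun x => -v x)
    (ℓ := fun x => -(ε ^ 2 * runningCost p Ω f x)) hv.neg (by simpa using hCv) hℓ.neg
    (by simpa only [abs_neg] using hCℓ)
    (fun x hx => by rw [runningCost, Set.indicator_of_notMem hx, mul_zero, neg_zero])
    (fun n k hk => by
      rw [runningCost, Set.indicator_of_mem hk, integral_neg]
      linarith [h n k hk]) n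
  have e : (fun ω : ℕ → Space d => -v (ω n) -
      ∑ i ∈ Finset.range n, -(ε ^ 2 * runningCost p Ω f (ω i))) =
      fun ω => -(v (ω n) - ∑ i ∈ Finset.range n, ε ^ 2 * runningCost p Ω f (ω i)) := by
    funext ω
    rw [Finset.sum_neg_distrib]
    ring
  rw [e, integral_neg] at hneg
  refine le_trans ?_ (neg_le_neg_iff.1 hneg)
  exact integral_mono ((integrable_comp_eval hp hε hΩ hf S₁ S₂ x₀ hu hCu n).sub (is n))
    ((integrable_comp_eval hp hε hΩ hf S₁ S₂ x₀ hv hCv n).sub (is n))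
    fun ω => sub_le_sub_right (huv _) _

end Positions

/-! ### Nearly optimal strategies -/

section Strategies

variable {d : ℕ} {p ε : ℝ} {Ω : Set (Space d)} {f g : Space d → ℝ}

/-- A strategy that, in every single round, is optimal up to `η` for the player who wants to maximize
`ψ` at the next position. -/
theorem exists_near_optimal_strategy (hp : 2 < p) (hε : 0 < ε) (hε1 : ε ≤ 1) {ψ : Space d → ℝ}
    {C η : ℝ} (hψ : Measurable ψ) (hC : ∀ x, |ψ x| ≤ C) (hη : 0 < η) :
    ∃ S : Strategy p d ε,
      (∀ n h, ∀ c ∈ Set.Icc (cMin p ε) (cMax p ε),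
        sSup (ψ '' ball h.last (jumpRadius p ε c)) - η ≤ ψ (S.jump n (h, c))) ∧
      (∀ n h, ∀ c ∈ Set.Icc (cMin p ε) (cMax p ε),
        sSup (ψ '' ball h.last (tugRadius p d ε c)) - η ≤ ψ (S.tug n (h, c))) ∧
      ∀ n h, roundValue p ε (-ψ) h.last (S.select n h) ≤ Aplus p ε (-ψ) h.last + η := by
  obtain ⟨σ, hσm, hσ⟩ := exists_measurable_near_sSup hC hη
  obtain ⟨s, hsm, hs⟩ := exists_measurable_near_Aplus (p := p) hp hε hε1 hψ.neg
    (by simpa using hC) hη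
  have hj : ∀ c ∈ Set.Icc (cMin p ε) (cMax p ε), 0 < jumpRadius p ε c := fun c hc =>
    jumpRadius_pos hε ((cMin_pos hε).trans_le hc.1)
  have ht : ∀ c ∈ Set.Icc (cMin p ε) (cMax p ε), 0 < tugRadius p d ε c := fun c hc =>
    tugRadius_pos hp hε hc.1
  refine ⟨{ select := fun n h => s h.last
            jump := fun n z => σ (z.1.last, jumpRadius p ε z.2)
            tug := fun n z => σ (z.1.last, tugRadius p d ε z.2)
            measurable_select := fun n => hsm.comp measurable_last
            measurable_jump := fun n => hσm.comp ((measurable_last.comp measurable_fst).prodMk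
              (measurable_jumpRadius.comp measurable_snd))
            measurable_tug := fun n => hσm.comp ((measurable_last.comp measurable_fst).prodMk
              (measurable_tugRadius.comp measurable_snd))
            select_mem := fun n h => (hs _).1
            jump_mem := fun n h c hc => (hσ _ _ (hj c hc)).1
            tug_mem := fun n h c hc => (hσ _ _ (ht c hc)).1 }, ?_, ?_, ?_⟩
  · exact fun n h c hc => (hσ _ _ (hj c hc)).2.le
  · exact fun n h c hc => (hσ _ _ (ht c hc)).2.le
  · exact fun n h => (hs _).2.le

variable (hp : 2 < p) (hε : 0 < ε) (hΩ : IsOpen Ω) (hf : ContinuousOn f (closure Ω))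

/-- Against every strategy of Player II, the strategy of Player I that is nearly optimal for a solution
`u` of the dynamic programming principle secures nearly `u`. The errors of the single rounds are absorbed
by a small multiple of the Lyapunov function. -/
theorem exists_strategy_le_expectedPayoff (hd : 1 ≤ d) (hε1 : ε ≤ 1)
    (hΩb : Bornology.IsBounded Ω) {u : Space d → ℝ} (hu : IsDPPSolution p ε Ω f g u) (x₀ : Space d)
    {t : ℝ} (ht : t < u x₀) :
    ∃ S₁, ∀ S₂, t ≤ expectedPayoff hp hε hΩ hf g S₁ S₂ x₀ := by
  obtain ⟨C, hC⟩ := hu.bounded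
  obtain ⟨Φ, K, hΦm, hΦ, hL⟩ := exists_lyapunov (Ω := Ω) hd hp hε hε1 hΩb
  have hΦ0 : ∀ x, 0 ≤ Φ x := fun x => zero_le_one.trans (hΦ x).1
  have hΦb : ∀ x, |Φ x| ≤ K := fun x => by rw [abs_of_nonneg (hΦ0 x)]; exact (hΦ x).2
  have hK : 0 < K := zero_lt_one.trans_le ((hΦ 0).1.trans (hΦ 0).2)
  -- A round costs at most `2 * η`, so the whole game costs at most `2 * η * Φ x₀`.
  obtain ⟨η, hη, hηK⟩ : ∃ η > 0, 2 * η * K = u x₀ - t :=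
    ⟨(u x₀ - t) / (2 * K), div_pos (sub_pos.2 ht) (by positivity), by field_simp⟩
  obtain ⟨S₁, hjump, htug, hsel⟩ := exists_near_optimal_strategy hp hε hε1 hu.measurable hC hη
  refine ⟨S₁, fun S₂ => ?_⟩
  have hvb : ∀ x, |u x - 2 * η * Φ x| ≤ C + 2 * η * K := fun x => by
    refine (abs_sub _ _).trans (add_le_add (hC x) ?_)
    rw [abs_mul, abs_of_pos (by positivity : 0 < 2 * η)]
    exact mul_le_mul_of_nonneg_left (hΦb x) (by positivity)
  have h := le_expectedPayoff hp hε hΩ hf S₁ S₂ x₀ hd hε1 hΩb hu.measurable hC hu.eq_outside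
    (v := fun x => u x - 2 * η * Φ x) (hu.measurable.sub (hΦm.const_mul _)) hvb
    (fun x => sub_le_self _ (mul_nonneg (by positivity) (hΦ0 x))) fun n h hh => ?_
  · have := mul_le_mul_of_nonneg_left (hΦ x₀).2 (by positivity : 0 ≤ 2 * η)
    linarith
  · have := isProbabilityMeasure_stepLaw hp hε Ω f S₁ S₂ n h
    rw [integral_sub (integrable_of_abs_le hu.measurable hC)
      ((integrable_of_abs_le hΦm hΦb).const_mul _), integral_const_mul]
    have hux := hu.eq_inside _ hh
    have hgoal : u h.last + ε ^ 2 * J p (f h.last) - 2 * η ≤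
          ∫ y, u y ∂(stepLaw p ε Ω f S₁ S₂ n h) ∧
        ∫ y, Φ y ∂(stepLaw p ε Ω f S₁ S₂ n h) ≤ Φ h.last - 1 := by
      by_cases h0 : 0 ≤ f h.last
      · have hc := S₂.select_mem n h
        rw [stepLaw, if_pos hh, if_pos h0]
        rw [A, if_pos h0] at hux
        refine ⟨?_, hL _ hh _ hc _ _ _⟩
        have h1 := roundValue_sub_le_integral hp hε hc.1 hu.measurable hC hη.le
          (hjump n h _ hc) (htug n h _ hc) (S₂.tug_mem n h _ hc)
        have h2 := Aplus_le_roundValue hp hε hu.measurable hC h.last hc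
        linarith
      · have hc := S₁.select_mem n h
        rw [stepLaw, if_pos hh, if_neg h0]
        rw [A, if_neg h0, Aminus_eq] at hux
        refine ⟨?_, hL _ hh _ hc _ _ _⟩
        -- Here Player I selects `c` and, in terms of `-u`, is the minimizing player.
        have hnear : (-u) (S₁.tug n (h, S₁.select n h)) ≤
            sInf ((-u) '' ball h.last (tugRadius p d ε (S₁.select n h))) + η := by
          rw [sInf_image_neg, Pi.neg_apply]
          linarith [htug n h _ hc]
        have h1 := integral_le_roundValue_add hp hε hc.1 hu.measurable.neg (by simpa using hC)
          hη.le (S₂.jump_mem n h _ hc) (S₂.tug_mem n h _ hc) hnear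
        have hneg : ∀ μ : Measure (Space d), ∫ y, (-u) y ∂μ = -∫ y, u y ∂μ :=
          fun μ => integral_neg _
        rw [hneg, roundLaw_comm] at h1
        linarith [hsel n h]
    have h3 := mul_le_mul_of_nonneg_left hgoal.2 (by positivity : 0 ≤ 2 * η)
    linarith [hgoal.1]

/-- The counterpart for Player II of `exists_strategy_le_expectedPayoff`. -/
theorem exists_strategy_expectedPayoff_le (hd : 1 ≤ d) (hε1 : ε ≤ 1)
    (hΩb : Bornology.IsBounded Ω) {u : Space d → ℝ} (hu : IsDPPSolution p ε Ω f g u) (x₀ : Space d)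
    {t : ℝ} (ht : u x₀ < t) :
    ∃ S₂, ∀ S₁, expectedPayoff hp hε hΩ hf g S₁ S₂ x₀ ≤ t := by
  obtain ⟨C, hC⟩ := hu.bounded
  have hC' : ∀ x, |(-u) x| ≤ C := by simpa using hC
  obtain ⟨Φ, K, hΦm, hΦ, hL⟩ := exists_lyapunov (Ω := Ω) hd hp hε hε1 hΩb
  have hΦ0 : ∀ x, 0 ≤ Φ x := fun x => zero_le_one.trans (hΦ x).1
  have hΦb : ∀ x, |Φ x| ≤ K := fun x => by rw [abs_of_nonneg (hΦ0 x)]; exact (hΦ x).2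
  have hK : 0 < K := zero_lt_one.trans_le ((hΦ 0).1.trans (hΦ 0).2)
  -- A round costs at most `2 * η`, so the whole game costs at most `2 * η * Φ x₀`.
  obtain ⟨η, hη, hηK⟩ : ∃ η > 0, 2 * η * K = t - u x₀ :=
    ⟨(t - u x₀) / (2 * K), div_pos (sub_pos.2 ht) (by positivity), by field_simp⟩
  obtain ⟨S₂, hjump, htug, hsel⟩ := exists_near_optimal_strategy hp hε hε1 hu.measurable.neg hC' hη
  rw [neg_neg] at hsel
  refine ⟨S₂, fun S₁ => ?_⟩
  have hvb : ∀ x, |u x + 2 * η * Φ x| ≤ C + 2 * η * K := fun x => by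
    refine (abs_add_le _ _).trans (add_le_add (hC x) ?_)
    rw [abs_mul, abs_of_pos (by positivity : 0 < 2 * η)]
    exact mul_le_mul_of_nonneg_left (hΦb x) (by positivity)
  have h := expectedPayoff_le hp hε hΩ hf S₁ S₂ x₀ hd hε1 hΩb hu.measurable hC hu.eq_outside
    (v := fun x => u x + 2 * η * Φ x) (hu.measurable.add (hΦm.const_mul _)) hvb
    (fun x => le_add_of_nonneg_right (mul_nonneg (by positivity) (hΦ0 x))) fun n h hh => ?_
  · have := mul_le_mul_of_nonneg_left (hΦ x₀).2 (by positivity : 0 ≤ 2 * η)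
    linarith
  · have := isProbabilityMeasure_stepLaw hp hε Ω f S₁ S₂ n h
    rw [integral_add (integrable_of_abs_le hu.measurable hC)
      ((integrable_of_abs_le hΦm hΦb).const_mul _), integral_const_mul]
    have hux := hu.eq_inside _ hh
    have hgoal : ∫ y, u y ∂(stepLaw p ε Ω f S₁ S₂ n h) ≤
          u h.last + ε ^ 2 * J p (f h.last) + 2 * η ∧
        ∫ y, Φ y ∂(stepLaw p ε Ω f S₁ S₂ n h) ≤ Φ h.last - 1 := by
      by_cases h0 : 0 ≤ f h.last
      · have hc := S₂.select_mem n h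
        rw [stepLaw, if_pos hh, if_pos h0]
        rw [A, if_pos h0] at hux
        refine ⟨?_, hL _ hh _ hc _ _ _⟩
        have hnear : u (S₂.tug n (h, S₂.select n h)) ≤
            sInf (u '' ball h.last (tugRadius p d ε (S₂.select n h))) + η := by
          have := htug n h _ hc
          rw [sSup_image_neg, Pi.neg_apply] at this
          linarith
        have h1 := integral_le_roundValue_add hp hε hc.1 hu.measurable hC
          hη.le (S₁.jump_mem n h _ hc) (S₁.tug_mem n h _ hc) hnear
        linarith [hsel n h]
      · have hc := S₁.select_mem n h
        rw [stepLaw, if_pos hh, if_neg h0]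
        rw [A, if_neg h0, Aminus_eq] at hux
        refine ⟨?_, hL _ hh _ hc _ _ _⟩
        -- Here Player II makes the free move and, in terms of `-u`, is the maximizing player.
        have h1 := roundValue_sub_le_integral hp hε hc.1 hu.measurable.neg hC' hη.le
          (hjump n h _ hc) (htug n h _ hc) (S₁.tug_mem n h _ hc)
        have h2 := Aplus_le_roundValue hp hε hu.measurable.neg hC' h.last hc
        have hneg : ∀ μ : Measure (Space d), ∫ y, (-u) y ∂μ = -∫ y, u y ∂μ :=
          fun μ => integral_neg _
        rw [hneg, roundLaw_comm] at h1
        linarith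
    have h3 := mul_le_mul_of_nonneg_left hgoal.2 (by positivity : 0 ≤ 2 * η)
    linarith [hgoal.1]

theorem valueI_le_valueII (x : Space d) :
    valueI hp hε hΩ hf g x ≤ valueII hp hε hΩ hf g x :=
  iSup_iInf_le_iInf_iSup _

theorem value_eq_of_isDPPSolution (hd : 1 ≤ d) (hε1 : ε ≤ 1)
    (hΩb : Bornology.IsBounded Ω) {u : Space d → ℝ} (hu : IsDPPSolution p ε Ω f g u) (x : Space d) :
    valueI hp hε hΩ hf g x = (u x : EReal) ∧ valueII hp hε hΩ hf g x = (u x : EReal) := by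
  have h1 : (u x : EReal) ≤ valueI hp hε hΩ hf g x := by
    refine EReal.ge_of_forall_gt_iff_ge.1 fun t ht => ?_
    obtain ⟨S₁, hS⟩ := exists_strategy_le_expectedPayoff hp hε hΩ hf hd hε1 hΩb hu x
      (EReal.coe_lt_coe_iff.1 ht)
    exact le_iSup_of_le S₁ (le_iInf fun S₂ => EReal.coe_le_coe_iff.2 (hS S₂))
  have h2 : valueII hp hε hΩ hf g x ≤ (u x : EReal) := by
    refine EReal.le_of_forall_lt_iff_le.1 fun t ht => ?_
    obtain ⟨S₂, hS⟩ := exists_strategy_expectedPayoff_le hp hε hΩ hf hd hε1 hΩb hu x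
      (EReal.coe_lt_coe_iff.1 ht)
    exact iInf_le_of_le S₂ (iSup_le fun S₁ => EReal.coe_le_coe_iff.2 (hS S₁))
  have h12 := valueI_le_valueII (g := g) hp hε hΩ hf x
  exact ⟨le_antisymm (h12.trans h2) h1, le_antisymm h2 (h1.trans h12)⟩

end Strategies

end GamblingHouse

theorem theorem5p1 {d : ℕ} (hd : 1 ≤ d) {p : ℝ} (hp : 2 < p)
    {Ω : Set (EuclideanSpace ℝ (Fin d))} (hΩ : IsOpen Ω) (hΩb : Bornology.IsBounded Ω)
    (hΩe : GamblingHouse.UniformExteriorBall Ω)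
    {f : EuclideanSpace ℝ (Fin d) → ℝ} (hf : ContinuousOn f (closure Ω))
    {g : EuclideanSpace ℝ (Fin d) → ℝ} (hg : ContinuousOn g Ωᶜ) (hgb : ∃ C : ℝ, ∀ x ∈ Ωᶜ, |g x| ≤ C)
    {ε : ℝ} (hε : 0 < ε) (hε1 : ε ≤ 1) :
    -- whatever the strategies, the game ends almost surely and the expected payoff makes sense
    (∀ (S₁ S₂ : GamblingHouse.Strategy p d ε) (x : EuclideanSpace ℝ (Fin d)),
      (∀ᵐ ω ∂(GamblingHouse.gameLaw hp hε hΩ hf S₁ S₂ x), ∃ n, ω n ∉ Ω) ∧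
      MeasureTheory.Integrable (GamblingHouse.payoff p ε Ω f g)
        (GamblingHouse.gameLaw hp hε hΩ hf S₁ S₂ x)) ∧
    -- the dynamic programming principle has a unique solution, which is the value of the game
    ∃ u : EuclideanSpace ℝ (Fin d) → ℝ,
      GamblingHouse.IsDPPSolution p ε Ω f g u ∧
      (∀ v : EuclideanSpace ℝ (Fin d) → ℝ, GamblingHouse.IsDPPSolution p ε Ω f g v → v = u) ∧
      ∀ x : EuclideanSpace ℝ (Fin d),
        GamblingHouse.valueI hp hε hΩ hf g x = (u x : EReal) ∧
        GamblingHouse.valueII hp hε hΩ hf g x = (u x : EReal) := by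
  refine ⟨fun S₁ S₂ x => ?_, ?_⟩
  · refine ⟨GamblingHouse.ae_exists_notMem hp hε hΩ hf S₁ S₂ x hd hε1 hΩb, ?_⟩
    obtain ⟨C, hC⟩ := hgb
    have hgC : ∀ y, |Ωᶜ.indicator g y| ≤ |C| := fun y => by
      by_cases hy : y ∈ Ωᶜ
      · rw [Set.indicator_of_mem hy]
        exact (hC y hy).trans (le_abs_self C)
      · rw [Set.indicator_of_notMem hy, abs_zero]
        exact abs_nonneg C
    exact (GamblingHouse.integrable_payoff_and_tendsto hp hε hΩ hf S₁ S₂ x hd hε1 hΩb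
      (GamblingHouse.measurable_indicator_of_continuousOn hΩ.measurableSet.compl hg) hgC
      fun y hy => Set.indicator_of_mem hy g).1
  · obtain ⟨u, hu, huniq⟩ :=
      GamblingHouse.exists_unique_isDPPSolution hd hp hε hε1 hΩ hΩb hf hg hgb
    exact ⟨u, hu, huniq, GamblingHouse.value_eq_of_isDPPSolution hp hε hΩ hf hd hε1 hΩb hu⟩
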